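/- All categories are small; composition is written in diagrammatic order ($fg$ is $f$ followed by $g$). **Restriction side.** A *restriction category* is a category $\mathbb X$ with, for each $f\colon A\to B$, an endomorphism $\bar f\colon A\to A$ such that $\bar f f=f$; $\bar f\bar g=\bar g\bar f$ and $\bar g\bar f=\overline{\bar g f}$ for $f\colon A\to B$, $g\colon A\to C$; and $f\bar g=\overline{fg}\,f$ for $f\colon A\to B$, $g\colon B\to C$. A morphism $f$ is *total* if $\bar f=\mathrm{id}$. Parallel morphisms $f,g$ are *compatible* if $\bar f g=\bar g f$, and $f\le g$ means $\bar f g=f$. A *join* of a family of morphisms $A\to B$ is a least upper bound for $\le$. A *join restriction category* is a restriction category in which every family (possibly empty) of pairwise compatible morphisms $A\to B$ has a join, and $g(\bigvee_i f_i)=\bigvee_i gf_i$, $(\bigvee_i f_i)h=\bigvee_i f_ih$. Let $\mathsf{jRCat}_{\mathsf{lax}}$ be the 2-category of join restriction categories, functors with $F(\bar f)=\overline{Ff}$ that preserve joins of compatible families, and restriction natural transformations: families of total morphisms $\varphi_A\colon FA\to GA$ with $(Ff)\varphi_B=(F\bar f)\varphi_A(Gf)$ for all $f\colon A\to B$. **Local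 side.** A *local category* is a category $\mathbb C$ with, for each object $M$, an object $\mathsf LM$ and a monic $\eta_M\colon M\to\mathsf LM$ such that $\mathsf L\mathsf LM=\mathsf LM$, $\eta_{\mathsf LM}=\mathrm{id}$, and for every $f\colon N\to\mathsf LM$ there is a pullback $P\to M$, $m\colon P\to N$ of $\eta_M$ along $f$ with $\mathsf LP=\mathsf LN$ and $m\eta_N=\eta_P$. An *inclusion* is a morphism $m\colon M\to N$ with $\mathsf LM=\mathsf LN$ and $m\eta_N=\eta_M$. For $f\colon A\to N$ and $g\colon B\to N$: $f\le g$ means $f=mg$ for an inclusion $m\colon A\to B$; $f,g$ are *compatible* if $\mathsf LA=\mathsf LB$ and $f,g$ agree on the pullback of $\eta_A$ and $\eta_B$. A *compatible family* over $\mathsf LK$ is a family (possibly empty) of pairwise compatible morphisms $f_i\colon M_i\to N$ with $\mathsf LM_i=\mathsf LK$; a *join* of it is a morphism $s\colon S\to N$ with $\mathsf LS=\mathsf LK$ that is an upper bound of the $f_i$ and satisfies $s\le g$ for every upper bound $g\colon T\to N$ with $\mathsf LT=\mathsf LK$. A *join local category* is a local category such that * (JL.1) every compatible family has a join; * (JL.2)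 if $s\colon S\to N$ is the join of a compatible family $f_i\colon M_i\to N$, $m_i\colon M_i\to S$ are the inclusions, $g\colon P\to\mathsf LS$ is a morphism, and $q_i\colon P\wedge M_i\to M_i$, $\pi_i\colon P\wedge M_i\to P$ (with $\pi_i$ an inclusion) form the pullback of $\eta_{M_i}$ along $g$ for each $i$, then the joins $\bigvee_i q_im_i\colon\bigvee_i(P\wedge M_i)\to S$ and $\bigvee_i\pi_i\colon\bigvee_i(P\wedge M_i)\to P$ (with a common domain) form a pullback of $\eta_S$ along $g$. Let $\mathsf{jLCat}_{\mathsf{lax}}$ be the 2-category of join local categories, local functors that preserve joins of compatible families (a *local functor* is a functor $F$ with $F\mathsf LM=\mathsf LFM$ and $F\eta_M=\eta_{FM}$ that preserves the pullbacks of each $\eta_M$ along all morphisms), and all natural transformations. **Theorem.** There is a 2-equivalence $\mathsf{jRCat}_{\mathsf{lax}}\simeq\mathsf{jLCat}_{\mathsf{lax}}$. That is, there are (strict) 2-functors $\mathbf L\colon\mathsf{jRCat}_{\mathsf{lax}}\to\mathsf{jLCat}_{\mathsf{lax}}$ and $\mathbf R\colon\mathsf{jLCat}_{\mathsf{lax}}\to\mathsf{jRCat}_{\mathsf{lax}}$,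 a (strictly) 2-natural transformation $\mathrm{id}\Rightarrow\mathbf R\mathbf L$ all of whose components are isomorphisms in $\mathsf{jRCat}_{\mathsf{lax}}$, and a (strictly) 2-natural transformation $\mathrm{id}\Rightarrow\mathbf L\mathbf R$ all of whose components are equivalences in the 2-category $\mathsf{jLCat}_{\mathsf{lax}}$. -/

import Mathlib

open CategoryTheory Bicategory

universe v u

/-! ### Restriction categories -/

/-- A restriction structure on a category. Composition is written in diagrammatic order, so
`f ≫ g` is `f` followed by `g`. -/
class RestrictionCategory (X : Type u) [Category.{v} X] where
  /-- The restriction idempotent of a morphism. -/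
  rest : ∀ {A B : X}, (A ⟶ B) → (A ⟶ A)
  rest_comp : ∀ {A B : X} (f : A ⟶ B), rest f ≫ f = f
  rest_comm : ∀ {A B C : X} (f : A ⟶ B) (g : A ⟶ C), rest f ≫ rest g = rest g ≫ rest f
  rest_rest_comp : ∀ {A B C : X} (f : A ⟶ B) (g : A ⟶ C),
    rest g ≫ rest f = rest (rest g ≫ f)
  comp_rest : ∀ {A B C : X} (f : A ⟶ B) (g : B ⟶ C), f ≫ rest g = rest (f ≫ g) ≫ f

namespace RestrictionCategory

variable {X : Type u} [Category.{v} X] [RestrictionCategory X]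

/-- A morphism is total when its restriction idempotent is the identity. -/
def IsTotal {A B : X} (f : A ⟶ B) : Prop := rest f = 𝟙 A

/-- Compatibility of parallel morphisms. -/
def Compatible {A B : X} (f g : A ⟶ B) : Prop := rest f ≫ g = rest g ≫ f

/-- The order on parallel morphisms: `g` bounds `f` from above. -/
def Le {A B : X} (f g : A ⟶ B) : Prop := rest f ≫ g = f

/-- `s` is the join of the family `f` of parallel morphisms. -/
structure IsJoin {A B : X} {ι : Type v} (f : ι → (A ⟶ B)) (s : A ⟶ B) : Prop where
  le : ∀ i, Le (f i) s
  least : ∀ h : A ⟶ B, (∀ i, Le (f i) h) → Le s h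

theorem rest_id (A : X) : rest (𝟙 A) = 𝟙 A := by
  simpa using rest_comp (𝟙 A)

theorem rest_rest {A B : X} (f : A ⟶ B) : rest (rest f) = rest f := by
  have h := rest_rest_comp (𝟙 A) f
  rw [rest_id, Category.comp_id] at h
  exact h.symm

theorem rest_comp_total {A B C : X} (f : A ⟶ B) (g : B ⟶ C) (hg : IsTotal g) :
    rest (f ≫ g) = rest f := by
  have h : f = rest (f ≫ g) ≫ f := by
    have := comp_rest f g
    rw [hg, Category.comp_id] at this
    exact this
  have h₁ : rest f = rest (f ≫ g) ≫ rest f := by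
    rw [rest_rest_comp, ← h]
  have h₂ : rest (f ≫ g) = rest f ≫ rest (f ≫ g) := by
    rw [rest_rest_comp, ← Category.assoc, rest_comp]
  rw [h₂, rest_comm, ← h₁]

end RestrictionCategory

open RestrictionCategory in
/-- A join restriction category: every family of compatible parallel morphisms (the empty one
included) has a join, and joins are stable under pre- and post-composition. -/
class JoinRestrictionCategory (X : Type u) [Category.{v} X] extends RestrictionCategory X where
  exists_join : ∀ {A B : X} {ι : Type v} (f : ι → (A ⟶ B)),
    (∀ i j, Compatible (f i) (f j)) → ∃ s, IsJoin f s
  comp_join : ∀ {A B C : X} {ι : Type v} (g : C ⟶ A) (f : ι → (A ⟶ B)) (s : A ⟶ B),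
    (∀ i j, Compatible (f i) (f j)) → IsJoin f s → IsJoin (fun i => g ≫ f i) (g ≫ s)
  join_comp : ∀ {A B C : X} {ι : Type v} (f : ι → (A ⟶ B)) (s : A ⟶ B) (h : B ⟶ C),
    (∀ i j, Compatible (f i) (f j)) → IsJoin f s → IsJoin (fun i => f i ≫ h) (s ≫ h)

section

variable (X : Type u) [Category.{v} X] [RestrictionCategory X]
  (Y : Type u) [Category.{v} Y] [RestrictionCategory Y]

/-- A restriction functor: a functor that preserves restriction idempotents. -/
structure RestrictionFunctor extends X ⥤ Y where
  map_rest : ∀ {A B : X} (f : A ⟶ B),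
    map (RestrictionCategory.rest f) = RestrictionCategory.rest (map f)

/-- A restriction functor that preserves joins of compatible families. -/
structure JoinRestrictionFunctor extends RestrictionFunctor X Y where
  map_join : ∀ {A B : X} {ι : Type v} (f : ι → (A ⟶ B)) (s : A ⟶ B),
    (∀ i j, RestrictionCategory.Compatible (f i) (f j)) →
    RestrictionCategory.IsJoin f s →
    RestrictionCategory.IsJoin (fun i => map (f i)) (map s)

variable {X Y}

/-- A restriction natural transformation: a family of total morphisms which is natural up to
restriction. -/
@[ext]
structure RestrictionTransformation (F G : RestrictionFunctor X Y) where
  app : ∀ A : X, F.obj A ⟶ G.obj A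
  total : ∀ A : X, RestrictionCategory.IsTotal (app A)
  naturality : ∀ {A B : X} (f : A ⟶ B),
    F.map f ≫ app B = F.map (RestrictionCategory.rest f) ≫ app A ≫ G.map f

end

/-! ### Local categories -/

/-- A local structure on a category: an enlargement `enl M` of each object `M` with a maximal
inclusion `incl M : M ⟶ enl M`. Equalities of objects are used through `eqToHom`. -/
class LocalCategory (C : Type u) [Category.{v} C] where
  /-- The enlargement of an object. -/
  enl : C → C
  /-- The maximal inclusion of an object. -/
  incl : ∀ M : C, M ⟶ enl M
  enl_enl : ∀ M : C, enl (enl M) = enl M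
  incl_enl : ∀ M : C, incl (enl M) = eqToHom (enl_enl M).symm
  mono_incl : ∀ M : C, Mono (incl M)
  exists_pullback : ∀ {M N : C} (f : N ⟶ enl M), ∃ (P : C) (q : P ⟶ M) (m : P ⟶ N),
    IsPullback q m (incl M) f ∧
      ∃ h : enl P = enl N, m ≫ incl N = incl P ≫ eqToHom h

namespace LocalCategory

variable {C : Type u} [Category.{v} C] [LocalCategory C]

/-- `m : M ⟶ N` commutes with the maximal inclusions (in particular `M` and `N` have the same
enlargement). There is at most one such morphism from `M` to `N`; it exists when `M ≤ N`. -/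
def IsInclusion {M N : C} (m : M ⟶ N) : Prop :=
  ∃ h : enl M = enl N, m ≫ incl N = incl M ≫ eqToHom h

/-- The order on morphisms with a common codomain: `g` bounds `f` from above. -/
def Le {A B D : C} (f : A ⟶ D) (g : B ⟶ D) : Prop :=
  ∃ m : A ⟶ B, IsInclusion m ∧ m ≫ g = f

/-- Compatibility of morphisms with a common codomain: their domains have the same enlargement
`L`, and they agree on the pullback of the two domains over `L`. -/
def Compatible {A B D : C} (f : A ⟶ D) (g : B ⟶ D) : Prop :=
  ∃ h : enl A = enl B, ∀ {P : C} (b : P ⟶ B) (a : P ⟶ A),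
    IsPullback b a (incl B) (incl A ≫ eqToHom h) → b ≫ g = a ≫ f

/-- `s : S ⟶ N` is the join of the family `f` of morphisms `M i ⟶ N`, all of whose domains have
the same enlargement as `K`. The object `K` only matters for the empty family, where it tells
in which enlargement the domain of the join lies: for a nonempty family the conditions on the
enlargements of `S` and `T` follow from the others. -/
structure IsJoin (K : C) {ι : Type (max u v)} {M : ι → C} {N : C} (f : ∀ i, M i ⟶ N)
    {S : C} (s : S ⟶ N) : Prop where
  enl_eq : enl S = enl K
  le : ∀ i, Le (f i) s
  least : ∀ {T : C} (g : T ⟶ N), enl T = enl K → (∀ i, Le (f i) g) → Le s g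

end LocalCategory

open LocalCategory in
/-- A join local category. A family of compatible morphisms consists of morphisms `f i : M i ⟶ N`
that are pairwise compatible; all `M i` have the same enlargement `enl K`, also when the family is
empty.

`exists_join`: every family of compatible morphisms has a join.

`pullback_join`: let `s : S ⟶ N` be the join of such a family, with inclusions `m i : M i ⟶ S`,
and let `g : P ⟶ enl S`. Let `Q i`, with `q i : Q i ⟶ M i` and the inclusion `π i : Q i ⟶ P`, be
the pullback of `incl (M i)` along `g`. Then the join `a : W ⟶ S` of the `q i ≫ m i` and the join
`b : W ⟶ P` of the `π i` form a pullback of `incl S` along `g`. -/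
class JoinLocalCategory (C : Type u) [Category.{v} C] extends LocalCategory C where
  exists_join : ∀ {K N : C} {ι : Type (max u v)} {M : ι → C} (f : ∀ i, M i ⟶ N),
    (∀ i, enl (M i) = enl K) → (∀ i j, Compatible (f i) (f j)) →
    ∃ (S : C) (s : S ⟶ N), IsJoin K f s
  pullback_join : ∀ {K N : C} {ι : Type (max u v)} {M : ι → C} (f : ∀ i, M i ⟶ N)
    (hM : ∀ i, enl (M i) = enl K) (_ : ∀ i j, Compatible (f i) (f j))
    {S : C} (s : S ⟶ N) (hs : IsJoin K f s)
    (m : ∀ i, M i ⟶ S) (_ : ∀ i, IsInclusion (m i))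
    {P : C} (g : P ⟶ enl S)
    (Q : ι → C) (q : ∀ i, Q i ⟶ M i) (π : ∀ i, Q i ⟶ P) (_ : ∀ i, IsInclusion (π i))
    (_ : ∀ i, IsPullback (q i) (π i) (incl (M i))
      (g ≫ eqToHom (hs.enl_eq.trans (hM i).symm))),
    ∃ (W : C) (a : W ⟶ S) (b : W ⟶ P),
      IsJoin P (fun i => q i ≫ m i) a ∧ IsJoin P π b ∧ IsPullback a b (incl S) g

section

variable (C : Type u) [Category.{v} C] [LocalCategory C]
  (D : Type u) [Category.{v} D] [LocalCategory D]

/-- A local functor: it preserves enlargements and maximal inclusions strictly, and the pullbacks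
of maximal inclusions along all morphisms. -/
structure LocalFunctor extends C ⥤ D where
  obj_enl : ∀ M : C, obj (LocalCategory.enl M) = LocalCategory.enl (obj M)
  map_incl : ∀ M : C,
    map (LocalCategory.incl M) = LocalCategory.incl (obj M) ≫ eqToHom (obj_enl M).symm
  map_isPullback : ∀ {M N P : C} (f : N ⟶ LocalCategory.enl M) (q : P ⟶ M) (m : P ⟶ N),
    IsPullback q m (LocalCategory.incl M) f →
    IsPullback (map q) (map m) (map (LocalCategory.incl M)) (map f)

/-- A local functor that preserves joins of compatible families. -/
structure JoinLocalFunctor extends LocalFunctor C D where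
  map_join : ∀ {K N : C} {ι : Type (max u v)} {M : ι → C} (f : ∀ i, M i ⟶ N)
    {S : C} (s : S ⟶ N),
    (∀ i, LocalCategory.enl (M i) = LocalCategory.enl K) →
    (∀ i j, LocalCategory.Compatible (f i) (f j)) →
    LocalCategory.IsJoin K f s →
    LocalCategory.IsJoin (obj K) (fun i => map (f i)) (map s)

end

/-! ### The 2-category of join restriction categories -/

/-- Small join restriction categories. -/
structure JRCat where
  carrier : Type u
  [category : Category.{u} carrier]
  [join : JoinRestrictionCategory carrier]

attribute [instance] JRCat.category JRCat.join

namespace JRCat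

instance : CategoryStruct JRCat.{u} where
  Hom X Y := JoinRestrictionFunctor X.carrier Y.carrier
  id X :=
    { toFunctor := 𝟭 X.carrier
      map_rest := fun _ => rfl
      map_join := fun _ _ _ h => h }
  comp F G :=
    { toFunctor := F.toFunctor ⋙ G.toFunctor
      map_rest := fun f => by
        change G.map (F.map _) = _
        rw [F.map_rest, G.map_rest]
        rfl
      map_join := fun f s hf hs => G.map_join _ _
        (fun i j => by
          have h := congrArg F.map (hf i j)
          rw [F.map_comp, F.map_comp, F.map_rest, F.map_rest] at h
          exact h)
        (F.map_join f s hf hs) }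

open RestrictionCategory

/-- The 2-morphisms are all restriction natural transformations. -/
instance (X Y : JRCat.{u}) : Category (X ⟶ Y) where
  Hom F G := RestrictionTransformation F.toRestrictionFunctor G.toRestrictionFunctor
  id F :=
    { app := fun A => 𝟙 (F.obj A)
      total := fun A => rest_id _
      naturality := fun f => by
        rw [Category.comp_id, Category.id_comp, ← F.map_comp, rest_comp] }
  comp {F G H} φ ψ :=
    { app := fun A => φ.app A ≫ ψ.app A
      total := fun A => by
        unfold RestrictionCategory.IsTotal
        rw [rest_comp_total _ _ (ψ.total A)]
        exact φ.total A
      naturality := fun {A B} f => by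
        have h₁ := φ.naturality f
        have h₂ := ψ.naturality f
        have h₃ := φ.naturality (rest f)
        rw [rest_rest] at h₃
        have e₁ : F.map (rest f) ≫ F.map (rest f) = F.map (rest f) := by
          rw [← F.map_comp]
          congr 1
          have := rest_comp (rest f)
          rwa [rest_rest] at this
        have e₂ : F.map (rest f) ≫ φ.app A ≫ G.map (rest f) = F.map (rest f) ≫ φ.app A :=
          h₃.symm
        calc F.map f ≫ φ.app B ≫ ψ.app B
            = F.map (rest f) ≫ φ.app A ≫ G.map f ≫ ψ.app B := by
              rw [← Category.assoc, h₁, Category.assoc, Category.assoc]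
          _ = (F.map (rest f) ≫ φ.app A ≫ G.map (rest f)) ≫ ψ.app A ≫ H.map f := by
              rw [h₂]; simp only [Category.assoc]
          _ = F.map (rest f) ≫ (φ.app A ≫ ψ.app A) ≫ H.map f := by
              rw [e₂]; simp only [Category.assoc] }
  id_comp _ := RestrictionTransformation.ext (funext fun _ => Category.id_comp _)
  comp_id _ := RestrictionTransformation.ext (funext fun _ => Category.comp_id _)
  assoc _ _ _ := RestrictionTransformation.ext (funext fun _ => Category.assoc _ _ _)

@[ext]
theorem hom₂_ext {X Y : JRCat.{u}} {F G : X ⟶ Y} {φ ψ : F ⟶ G}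
    (h : ∀ A, φ.app A = ψ.app A) : φ = ψ :=
  RestrictionTransformation.ext (funext h)

/-- Whiskering: the components are `φ (F A)`. -/
def whiskerL {X Y Z : JRCat.{u}} (F : X ⟶ Y) {G H : Y ⟶ Z} (φ : G ⟶ H) : F ≫ G ⟶ F ≫ H :=
  RestrictionTransformation.mk (fun A => φ.app (F.obj A)) (fun _ => φ.total _) (fun f => by
    change G.map (F.map f) ≫ _ = G.map (F.map (rest f)) ≫ _
    rw [F.map_rest]
    exact φ.naturality (F.map f))

/-- Whiskering: the components are `H (φ A)`. -/
def whiskerR {X Y Z : JRCat.{u}} {F G : X ⟶ Y} (φ : F ⟶ G) (H : Y ⟶ Z) : F ≫ H ⟶ G ≫ H :=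
  RestrictionTransformation.mk (fun A => H.map (φ.app A))
    (fun A => by
      unfold RestrictionCategory.IsTotal
      refine (H.map_rest (φ.app A)).symm.trans ?_
      rw [φ.total A]
      exact H.map_id _)
    (fun f => by
      have h := congrArg H.map (φ.naturality f)
      rw [H.map_comp, H.map_comp, H.map_comp] at h
      exact h)

instance : Bicategory JRCat.{u} where
  whiskerLeft F _ _ φ := whiskerL F φ
  whiskerRight φ H := whiskerR φ H
  associator F G H := ⟨𝟙 (F ≫ G ≫ H), 𝟙 (F ≫ G ≫ H), Category.id_comp _, Category.id_comp _⟩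
  leftUnitor F := ⟨𝟙 F, 𝟙 F, Category.id_comp _, Category.id_comp _⟩
  rightUnitor F := ⟨𝟙 F, 𝟙 F, Category.id_comp _, Category.id_comp _⟩
  whiskerLeft_id _ _ := rfl
  whiskerLeft_comp _ _ _ _ _ _ := rfl
  id_whiskerLeft _ := by ext A; exact ((Category.id_comp _).trans (Category.comp_id _)).symm
  comp_whiskerLeft _ _ _ _ _ := by
    ext A; exact ((Category.id_comp _).trans (Category.comp_id _)).symm
  id_whiskerRight F G := by ext A; exact G.map_id _
  comp_whiskerRight _ _ G := by ext A; exact G.map_comp _ _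
  whiskerRight_id _ := by ext A; exact ((Category.id_comp _).trans (Category.comp_id _)).symm
  whiskerRight_comp _ _ _ := by
    ext A; exact ((Category.id_comp _).trans (Category.comp_id _)).symm
  whisker_assoc _ _ _ _ _ := by
    ext A; exact ((Category.id_comp _).trans (Category.comp_id _)).symm
  whisker_exchange {X Y Z F G H K} φ ψ := by
    ext A
    change ψ.app (F.obj A) ≫ K.map (φ.app A) = H.map (φ.app A) ≫ ψ.app (G.obj A)
    have h := ψ.naturality (φ.app A)
    rw [φ.total A] at h
    have h' : H.map (𝟙 (F.obj A)) = 𝟙 _ := H.map_id _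
    rw [h', Category.id_comp] at h
    exact h.symm
  pentagon F G H K := by
    ext A
    change K.map (𝟙 _) ≫ 𝟙 _ ≫ 𝟙 _ = 𝟙 _ ≫ 𝟙 _
    rw [K.map_id, Category.id_comp]
  triangle F G := by
    ext A
    change 𝟙 _ ≫ 𝟙 _ = G.map (𝟙 _)
    rw [G.map_id, Category.id_comp]

instance : Bicategory.Strict JRCat.{u} where
  id_comp _ := rfl
  comp_id _ := rfl
  assoc _ _ _ := rfl
  leftUnitor_eqToIso _ := rfl
  rightUnitor_eqToIso _ := rfl
  associator_eqToIso _ _ _ := rfl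

end JRCat

/-! ### The 2-category of join local categories -/

/-- Small join local categories. -/
structure JLCat where
  carrier : Type u
  [category : Category.{u} carrier]
  [join : JoinLocalCategory carrier]

attribute [instance] JLCat.category JLCat.join

namespace JLCat

open LocalCategory

theorem map_eqToHom_of {C D : Type u} [Category.{u} C] [Category.{u} D] (F : C ⥤ D)
    {A B : C} (h : A = B) {h' : F.obj A = F.obj B} : F.map (eqToHom h) = eqToHom h' := by
  subst h
  exact F.map_id _

theorem map_compatible {C D : Type u} [Category.{u} C] [Category.{u} D] [LocalCategory C]
    [LocalCategory D] (F : LocalFunctor C D) {A B N : C} {f : A ⟶ N} {g : B ⟶ N}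
    (hc : Compatible f g) : Compatible (F.map f) (F.map g) := by
  obtain ⟨h, hc⟩ := hc
  have h' : enl (F.obj A) = enl (F.obj B) := by
    rw [← F.obj_enl, ← F.obj_enl, h]
  refine ⟨h', fun {Q} b a hQ => ?_⟩
  obtain ⟨P, b₀, a₀, hP, -⟩ := exists_pullback (incl A ≫ eqToHom h)
  have hF := F.map_isPullback _ _ _ hP
  have key : b ≫ F.map (incl B) = a ≫ F.map (incl A ≫ eqToHom h) := by
    rw [F.map_comp, F.map_incl, F.map_incl,
      map_eqToHom_of F.toFunctor h (h' := congrArg F.obj h), ← Category.assoc, hQ.w]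
    simp
  have e := congrArg F.map (hc b₀ a₀ hP)
  rw [F.map_comp, F.map_comp] at e
  rw [← hF.lift_fst b a key, Category.assoc, e, ← Category.assoc, hF.lift_snd]

instance : CategoryStruct JLCat.{u} where
  Hom C D := JoinLocalFunctor C.carrier D.carrier
  id C :=
    { toFunctor := 𝟭 C.carrier
      obj_enl := fun _ => rfl
      map_incl := fun M => (Category.comp_id _).symm
      map_isPullback := fun _ _ _ h => h
      map_join := fun _ _ _ _ _ hs => hs }
  comp F G :=
    { toFunctor := F.toFunctor ⋙ G.toFunctor
      obj_enl := fun M => by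
        change G.obj (F.obj _) = _
        rw [F.obj_enl, G.obj_enl]
        rfl
      map_incl := fun M => by
        change G.map (F.map _) = _
        rw [F.map_incl, G.map_comp, G.map_incl,
          map_eqToHom_of G.toFunctor _ (h' := congrArg G.obj (F.obj_enl M).symm)]
        simp
      map_isPullback := fun {M N P} f q m h => by
        have h₁ := F.map_isPullback f q m h
        have hw := F.map_incl M
        have h₂ : IsPullback (F.map q) (F.map m) (incl (F.obj M))
            (F.map f ≫ eqToHom (F.obj_enl M)) := by
          refine IsPullback.of_iso h₁ (Iso.refl _) (Iso.refl _) (Iso.refl _)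
            (eqToIso (F.obj_enl M)) ?_ ?_ ?_ ?_ <;> simp [hw]
        have h₃ := G.map_isPullback _ _ _ h₂
        refine IsPullback.of_iso h₃ (Iso.refl _) (Iso.refl _) (Iso.refl _)
            (eqToIso (congrArg G.obj (F.obj_enl M).symm)) ?_ ?_ ?_ ?_
        · simp
        · simp
        · simp [hw, map_eqToHom_of G.toFunctor _ (h' := congrArg G.obj (F.obj_enl M).symm)]
        · simp [map_eqToHom_of G.toFunctor _ (h' := congrArg G.obj (F.obj_enl M))]
      map_join := fun {K N ι M} f S s hM hf hs => G.map_join _ _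
        (fun i => by
          have e := congrArg F.obj (hM i)
          rw [F.obj_enl, F.obj_enl] at e
          exact e)
        (fun i j => map_compatible F.toLocalFunctor (hf i j))
        (F.map_join f s hM hf hs) }

/-- The 2-morphisms are all natural transformations. -/
instance (C D : JLCat.{u}) : Category (C ⟶ D) where
  Hom F G := NatTrans F.toFunctor G.toFunctor
  id F := NatTrans.id F.toFunctor
  comp φ ψ := NatTrans.vcomp φ ψ
  id_comp _ := NatTrans.ext (funext fun _ => Category.id_comp _)
  comp_id _ := NatTrans.ext (funext fun _ => Category.comp_id _)
  assoc _ _ _ := NatTrans.ext (funext fun _ => Category.assoc _ _ _)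

@[ext]
theorem hom₂_ext {C D : JLCat.{u}} {F G : C ⟶ D} {φ ψ : F ⟶ G}
    (h : ∀ A, φ.app A = ψ.app A) : φ = ψ :=
  NatTrans.ext (funext h)

/-- Whiskering: the components are `φ (F A)`. -/
def whiskerL {X Y Z : JLCat.{u}} (F : X ⟶ Y) {G H : Y ⟶ Z} (φ : G ⟶ H) : F ≫ G ⟶ F ≫ H :=
  NatTrans.mk (fun A => φ.app (F.obj A)) (fun _ _ f => φ.naturality (F.map f))

/-- Whiskering: the components are `H (φ A)`. -/
def whiskerR {X Y Z : JLCat.{u}} {F G : X ⟶ Y} (φ : F ⟶ G) (H : Y ⟶ Z) : F ≫ H ⟶ G ≫ H :=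
  NatTrans.mk (fun A => H.map (φ.app A)) (fun _ _ f => by
    have h := congrArg H.map (φ.naturality f)
    rw [H.map_comp, H.map_comp] at h
    exact h)

instance : Bicategory JLCat.{u} where
  whiskerLeft F _ _ φ := whiskerL F φ
  whiskerRight φ H := whiskerR φ H
  associator F G H := ⟨𝟙 (F ≫ G ≫ H), 𝟙 (F ≫ G ≫ H), Category.id_comp _, Category.id_comp _⟩
  leftUnitor F := ⟨𝟙 F, 𝟙 F, Category.id_comp _, Category.id_comp _⟩
  rightUnitor F := ⟨𝟙 F, 𝟙 F, Category.id_comp _, Category.id_comp _⟩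
  whiskerLeft_id _ _ := rfl
  whiskerLeft_comp _ _ _ _ _ _ := rfl
  id_whiskerLeft _ := by ext A; exact ((Category.id_comp _).trans (Category.comp_id _)).symm
  comp_whiskerLeft _ _ _ _ _ := by
    ext A; exact ((Category.id_comp _).trans (Category.comp_id _)).symm
  id_whiskerRight F G := by ext A; exact G.map_id _
  comp_whiskerRight _ _ G := by ext A; exact G.map_comp _ _
  whiskerRight_id _ := by ext A; exact ((Category.id_comp _).trans (Category.comp_id _)).symm
  whiskerRight_comp _ _ _ := by
    ext A; exact ((Category.id_comp _).trans (Category.comp_id _)).symm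
  whisker_assoc _ _ _ _ _ := by
    ext A; exact ((Category.id_comp _).trans (Category.comp_id _)).symm
  whisker_exchange {X Y Z F G H K} φ ψ := by
    ext A
    exact (ψ.naturality (φ.app A)).symm
  pentagon F G H K := by
    ext A
    change K.map (𝟙 _) ≫ 𝟙 _ ≫ 𝟙 _ = 𝟙 _ ≫ 𝟙 _
    rw [K.map_id, Category.id_comp]
  triangle F G := by
    ext A
    change 𝟙 _ ≫ 𝟙 _ = G.map (𝟙 _)
    rw [G.map_id, Category.id_comp]

instance : Bicategory.Strict JLCat.{u} where
  id_comp _ := rfl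
  comp_id _ := rfl
  assoc _ _ _ := rfl
  leftUnitor_eqToIso _ := rfl
  rightUnitor_eqToIso _ := rfl
  associator_eqToIso _ _ _ := rfl

end JLCat

/-! ### 2-equivalences -/

section

universe w₁ v₁ u₁ w₂ v₂ u₂

variable {B : Type u₁} [Bicategory.{w₁, v₁} B] {C : Type u₂} [Bicategory.{w₂, v₂} C]

/-- A 2-natural transformation between 2-functors (both squares commute on the nose). -/
structure TwoNatTrans (F G : StrictPseudofunctor B C) where
  app : ∀ a : B, F.obj a ⟶ G.obj a
  naturality : ∀ {a b : B} (f : a ⟶ b), F.map f ≫ app b = app a ≫ G.map f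
  naturality₂ : ∀ {a b : B} {f g : a ⟶ b} (θ : f ⟶ g),
    F.map₂ θ ▷ app b ≫ eqToHom (naturality g) =
      eqToHom (naturality f) ≫ app a ◁ G.map₂ θ

/-- A 1-morphism of a bicategory is an (internal) equivalence. -/
def IsEquivalenceOne {a b : B} (f : a ⟶ b) : Prop :=
  ∃ e : Bicategory.Equivalence a b, e.hom = f

/-- A 1-morphism of a bicategory has an inverse on the nose. -/
def IsIsoOne {a b : B} (f : a ⟶ b) : Prop :=
  ∃ g : b ⟶ a, f ≫ g = 𝟙 a ∧ g ≫ f = 𝟙 b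

variable (B C)

/-- A 2-equivalence of 2-categories: 2-functors in both directions, and 2-natural transformations
from the identities to the two composites, all of whose components are equivalences. -/
structure TwoEquivalence where
  functor : StrictPseudofunctor B C
  inverse : StrictPseudofunctor C B
  unit : TwoNatTrans (StrictPseudofunctor.id B) (functor.comp inverse)
  unit_equivalence : ∀ a : B, IsEquivalenceOne (unit.app a)
  counit : TwoNatTrans (StrictPseudofunctor.id C) (inverse.comp functor)
  counit_equivalence : ∀ c : C, IsEquivalenceOne (counit.app c)

end

/-! A restriction idempotent is a formal subobject, and a partial map is a total map defined on a
subobject; the two constructions pass between these descriptions. From a restriction category `X`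
one forms `Dom X`: objects are restriction idempotents `e` on `A`, maps from `(A, e)` to `(B, d)`
are the `f : A ⟶ B` with domain `e` and values in `d`, and the enlargement of `(A, e)` is `(A, 𝟙
A)`. From a local category `C` one forms `Enlarged C`: objects are the `K` that equal their
enlargement, and morphisms are partial maps, that is, spans of an inclusion `M ⟶ K` and a map `M ⟶
N`, up to isomorphism. A span is encoded by the relation it defines on generalized elements.
Composition is then composition of relations, equality is extensional, and all strict 2-functor laws
hold on the nose without quotients or chosen pullbacks.

Joins transfer in both directions. In `Dom X` the order, compatibility and joins are those of the
underlying maps. (JL.1) is then existence of joins in `X`, and (JL.2) follows because precomposition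
and restriction both commute with joins (`IsJoin.rest`). Conversely, stability of joins of partial
maps under composition comes from covers: the inclusions into the domain of a join form a cover,
every map is the join of its restrictions to a cover, and (JL.2) makes covers stable under pullback
(`IsJoin.isCover`, `IsCover.isJoin`, `IsCover.pullback`).

The unit sends `f` to the partial map with span `(rest f, f)`. It is fully faithful, and bijective
on objects because the enlarged objects of `Dom X` are exactly the identity idempotents, so it is an
isomorphism. The counit sends `M` to the idempotent represented by its maximal inclusion. It is
fully faithful and surjective on objects, but it identifies objects that include into each other.
Hence it is only an equivalence, and its inverse needs preimages chosen compatibly with enlargements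
(`LocalFunctor.exists_section`). -/

theorem CategoryTheory.IsPullback.of_exists_lift {C : Type u} [Category.{v} C] {P M N L : C}
    {q : P ⟶ M} {m : P ⟶ N} {i : M ⟶ L} {f : N ⟶ L} (hi : Mono i) (hm : Mono m)
    (w : q ≫ i = m ≫ f)
    (h : ∀ {T : C} (b : T ⟶ M) (a : T ⟶ N), b ≫ i = a ≫ f → ∃ u : T ⟶ P, u ≫ m = a) :
    IsPullback q m i f :=
  ⟨⟨w⟩, ⟨Limits.PullbackCone.IsLimit.mk w (fun s => (h s.fst s.snd s.condition).choose)
    (fun s => by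
      rw [← cancel_mono i, Category.assoc, w, ← Category.assoc,
        (h s.fst s.snd s.condition).choose_spec, s.condition])
    (fun s => (h s.fst s.snd s.condition).choose_spec)
    (fun s u _ hu => by
      rw [← cancel_mono m, hu, (h s.fst s.snd s.condition).choose_spec])⟩⟩

/-! ### Restriction categories: order and joins -/

namespace RestrictionCategory

section

variable {X : Type u} [Category.{v} X] [RestrictionCategory X]

theorem rest_comp_rest {A B C : X} (f : A ⟶ B) (g : B ⟶ C) :
    rest (f ≫ rest g) = rest (f ≫ g) := by
  rw [comp_rest, ← rest_rest_comp, rest_comm, rest_rest_comp, ← Category.assoc, rest_comp]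

theorem rest_comp_rest_left {A B C : X} (f : A ⟶ B) (g : B ⟶ C) :
    rest f ≫ rest (f ≫ g) = rest (f ≫ g) := by
  rw [rest_rest_comp, ← Category.assoc, rest_comp]

theorem Le.antisymm {A B : X} {f g : A ⟶ B} (h : Le f g) (h' : Le g f) : f = g := by
  have h₁ : rest f = rest f ≫ rest g := by rw [rest_rest_comp, h]
  have h₂ : rest g = rest g ≫ rest f := by rw [rest_rest_comp, h']
  have h₃ : rest f = rest g := by rw [h₁, rest_comm, ← h₂]
  rw [← h, h₃, rest_comp]

theorem Le.rest_comp_rest {A B : X} {f g : A ⟶ B} (h : Le f g) : rest f ≫ rest g = rest f := by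
  rw [rest_rest_comp, h]

theorem Le.rest {A B : X} {f g : A ⟶ B} (h : Le f g) :
    Le (RestrictionCategory.rest f) (RestrictionCategory.rest g) := by
  unfold Le
  rw [rest_rest, h.rest_comp_rest]

theorem Compatible.rest {A B : X} (f g : A ⟶ B) :
    Compatible (RestrictionCategory.rest f) (RestrictionCategory.rest g) := by
  unfold Compatible
  rw [rest_rest, rest_rest, rest_comm]

theorem IsJoin.unique {A B : X} {ι : Type v} {f : ι → (A ⟶ B)} {s t : A ⟶ B}
    (hs : IsJoin f s) (ht : IsJoin f t) : s = t :=
  (hs.least _ ht.le).antisymm (ht.least _ hs.le)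

end

variable {X : Type u} [Category.{v} X] [JoinRestrictionCategory X]

/-- The join `e` of the idempotents `rest (f i)` lies below the identity, so it is itself a
restriction idempotent. Since `e ≫ s` is the join of the maps `rest (f i) ≫ s = f i`, it equals `s`,
which gives `rest s ≤ e`; the other inequality is monotonicity of `rest`. -/
theorem IsJoin.rest {A B : X} {ι : Type v} {f : ι → (A ⟶ B)} {s : A ⟶ B}
    (hs : IsJoin f s) :
    IsJoin (fun i => RestrictionCategory.rest (f i)) (RestrictionCategory.rest s) := by
  obtain ⟨e, he⟩ := JoinRestrictionCategory.exists_join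
    (fun i => RestrictionCategory.rest (f i)) (fun i j => Compatible.rest _ _)
  have he₁ : Le e (𝟙 A) := he.least _ fun i => by
    unfold Le
    rw [rest_rest, Category.comp_id]
  have he₂ : RestrictionCategory.rest e = e := by
    unfold Le at he₁
    rwa [Category.comp_id] at he₁
  have h₁ := JoinRestrictionCategory.join_comp _ _ s (fun i j => Compatible.rest _ _) he
  have h₂ : (fun i => RestrictionCategory.rest (f i) ≫ s) = f := funext fun i => hs.le i
  rw [h₂] at h₁
  have h₃ : e ≫ s = s := h₁.unique hs
  have h₄ : e = RestrictionCategory.rest s := by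
    refine (he.least _ fun i => (hs.le i).rest).antisymm ?_
    unfold Le
    rw [rest_rest, ← he₂, rest_comm, rest_rest_comp, he₂, h₃]
  exact h₄ ▸ he

end RestrictionCategory

/-! ### The local category of restriction idempotents -/

/-- The restriction idempotents of a restriction category, as the objects of a local category. -/
@[ext]
structure Dom (X : Type u) [Category.{v} X] [RestrictionCategory X] where
  base : X
  idem : base ⟶ base
  rest_idem : RestrictionCategory.rest idem = idem

namespace Dom

open RestrictionCategory

section

variable {X : Type u} [Category.{v} X] [RestrictionCategory X]

/-- Morphisms of restriction idempotents: total maps between the corresponding subobjects. -/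
@[ext]
structure Hom (P Q : Dom X) where
  val : P.base ⟶ Q.base
  rest_val : rest val = P.idem
  val_idem : val ≫ Q.idem = val

theorem idem_idem (P : Dom X) : P.idem ≫ P.idem = P.idem := by
  have h := rest_comp P.idem
  rwa [P.rest_idem] at h

theorem Hom.idem_val {P Q : Dom X} (f : Hom P Q) : P.idem ≫ f.val = f.val := by
  have h := rest_comp f.val
  rwa [f.rest_val] at h

/-- A map with values in `P` loses none of its domain when followed by a map whose domain is `P`;
this is why morphisms of `Dom X` compose. -/
theorem rest_comp_eq {A : X} {P Q : Dom X} (f : A ⟶ P.base) (hf : f ≫ P.idem = f) (g : Hom P Q) :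
    rest (f ≫ g.val) = rest f := by
  rw [← rest_comp_rest, g.rest_val, hf]

instance : Category.{v} (Dom X) where
  Hom := Hom
  id P := ⟨P.idem, P.rest_idem, P.idem_idem⟩
  comp f g := ⟨f.val ≫ g.val, by rw [rest_comp_eq _ f.val_idem, f.rest_val],
    by rw [Category.assoc, g.val_idem]⟩
  id_comp f := Hom.ext f.idem_val
  comp_id f := Hom.ext f.val_idem
  assoc _ _ _ := Hom.ext (Category.assoc _ _ _)

@[ext]
theorem hom_ext {P Q : Dom X} {f g : P ⟶ Q} (h : f.val = g.val) : f = g := Hom.ext h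

@[simp] theorem id_val (P : Dom X) : Hom.val (𝟙 P) = P.idem := rfl

@[simp] theorem comp_val {P Q R : Dom X} (f : P ⟶ Q) (g : Q ⟶ R) :
    (f ≫ g).val = f.val ≫ g.val := rfl

/-- The identity of `P` has underlying map `P.idem`, so a transport carries this idempotent as an
extra factor. In a composite with another morphism the factor is absorbed, as in the two variants
that follow. -/
theorem eqToHom_val {P Q : Dom X} (h : P = Q) :
    (eqToHom h).val = P.idem ≫ eqToHom (congrArg Dom.base h) := by
  subst h
  simp

theorem comp_eqToHom_val {P Q R : Dom X} (f : P ⟶ Q) (h : Q = R) (h' : Q.base = R.base) :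
    (f ≫ eqToHom h).val = f.val ≫ eqToHom h' := by
  subst h
  simp

theorem eqToHom_comp_val {P Q R : Dom X} (h : P = Q) (f : Q ⟶ R) (h' : P.base = Q.base) :
    (eqToHom h ≫ f).val = eqToHom h' ≫ f.val := by
  subst h
  simp

theorem mono_of_val_eq {P : Dom X} {e : P.base ⟶ P.base} {he : rest e = e}
    (m : P ⟶ ⟨P.base, e, he⟩) (hm : m.val = P.idem) : Mono m := ⟨fun g h w => by
  have w' := congrArg Hom.val w
  rw [comp_val, comp_val, hm, g.val_idem, h.val_idem] at w'
  exact hom_ext w'⟩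

/-- The whole object, as a restriction idempotent. -/
abbrev full (A : X) : Dom X := ⟨A, 𝟙 A, rest_id A⟩

/-- The maximal inclusion. -/
def toFull (P : Dom X) : P ⟶ full P.base := ⟨P.idem, P.rest_idem, Category.comp_id _⟩

instance (P : Dom X) : Mono P.toFull := mono_of_val_eq _ rfl

/-- The restriction of a morphism to the preimage of an idempotent. -/
def pullbackFst (P : Dom X) {N : Dom X} (f : N ⟶ full P.base) :
    (⟨N.base, rest (f.val ≫ P.idem), rest_rest _⟩ : Dom X) ⟶ P :=
  ⟨f.val ≫ P.idem, rfl, by rw [Category.assoc, P.idem_idem]⟩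

/-- The inclusion of the preimage of an idempotent. -/
def pullbackSnd (P : Dom X) {N : Dom X} (f : N ⟶ full P.base) :
    (⟨N.base, rest (f.val ≫ P.idem), rest_rest _⟩ : Dom X) ⟶ N :=
  ⟨rest (f.val ≫ P.idem), rest_rest _, by
    rw [← N.rest_idem, rest_comm, N.rest_idem, ← f.rest_val, rest_comp_rest_left]⟩

/-- The preimage of an idempotent `e` under `f` is `rest (f ≫ e)`. A cone `(b, a)` has `b = a ≫ f`
with values in `e`, so `a ≫ rest (f ≫ e) = rest b ≫ a = a`, and `a` itself is the lift. -/
theorem isPullback_toFull (P : Dom X) {N : Dom X} (f : N ⟶ full P.base) :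
    IsPullback (pullbackFst P f) (pullbackSnd P f) P.toFull f := by
  refine IsPullback.of_exists_lift inferInstance (mono_of_val_eq _ rfl) ?_ ?_
  · ext
    change (f.val ≫ P.idem) ≫ P.idem = rest (f.val ≫ P.idem) ≫ f.val
    rw [Category.assoc, P.idem_idem]
    conv_lhs => rw [← P.rest_idem, comp_rest]
  · intro T b a w
    have w' : b.val ≫ P.idem = a.val ≫ f.val := congrArg Hom.val w
    rw [b.val_idem] at w'
    refine ⟨⟨a.val, a.rest_val, ?_⟩, hom_ext ?_⟩
    · change a.val ≫ rest (f.val ≫ P.idem) = a.val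
      rw [comp_rest, ← Category.assoc, ← w', b.val_idem, b.rest_val, a.idem_val]
    · change a.val ≫ rest (f.val ≫ P.idem) = a.val
      rw [comp_rest, ← Category.assoc, ← w', b.val_idem, b.rest_val, a.idem_val]

instance : LocalCategory (Dom X) where
  enl P := full P.base
  incl P := P.toFull
  enl_enl _ := rfl
  incl_enl _ := rfl
  mono_incl _ := inferInstance
  exists_pullback {P N} f := ⟨_, pullbackFst P f, pullbackSnd P f, isPullback_toFull P f, rfl, by
    rw [eqToHom_refl, Category.comp_id]
    ext
    exact (pullbackSnd P f).val_idem⟩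

open LocalCategory

theorem base_eq_of_enl_eq {P Q : Dom X} (h : enl P = enl Q) : P.base = Q.base :=
  (Dom.ext_iff.1 (show full P.base = full Q.base from h)).1

/-- Objects with the same enlargement as `K` are given by restriction idempotents on the object
underlying `K`. -/
theorem exists_idem {K P : Dom X} (h : enl P = enl K) :
    ∃ (e : K.base ⟶ K.base) (he : rest e = e), P = ⟨K.base, e, he⟩ := by
  obtain ⟨A, e, he⟩ := P
  obtain rfl : A = K.base := base_eq_of_enl_eq h
  exact ⟨e, he, rfl⟩

theorem exists_idem_family {ι : Type*} {K : Dom X} {M : ι → Dom X} (h : ∀ i, enl (M i) = enl K) :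
    ∃ (e : ι → (K.base ⟶ K.base)) (he : ∀ i, rest (e i) = e i),
      M = fun i => ⟨K.base, e i, he i⟩ := by
  choose e he h using fun i => exists_idem (h i)
  exact ⟨e, he, funext h⟩

theorem isInclusion_iff {A : X} {e d : A ⟶ A} {he : rest e = e} {hd : rest d = d}
    (m : (⟨A, e, he⟩ : Dom X) ⟶ ⟨A, d, hd⟩) : IsInclusion m ↔ m.val = e := by
  constructor
  · rintro ⟨h, w⟩
    have w' := congrArg Hom.val w
    rw [eqToHom_refl, Category.comp_id] at w'
    exact m.val_idem.symm.trans w'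
  · refine fun h => ⟨rfl, hom_ext ?_⟩
    rw [eqToHom_refl, Category.comp_id]
    exact m.val_idem.trans h

/-- An inclusion `(A, e) ⟶ (A, d)` can only be `e`, and it exists when `e ≫ d = e`. The order on
underlying maps already forces this relation between their domains. -/
theorem le_iff {A : X} {e d : A ⟶ A} {he : rest e = e} {hd : rest d = d} {N : Dom X}
    (f : (⟨A, e, he⟩ : Dom X) ⟶ N) (g : (⟨A, d, hd⟩ : Dom X) ⟶ N) :
    LocalCategory.Le f g ↔ RestrictionCategory.Le f.val g.val := by
  have hf : rest f.val = e := f.rest_val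
  have hg : rest g.val = d := g.rest_val
  constructor
  · rintro ⟨m, hm, w⟩
    rw [isInclusion_iff] at hm
    have w' : e ≫ g.val = f.val := (congrArg (· ≫ g.val) hm).symm.trans (congrArg Hom.val w)
    unfold RestrictionCategory.Le
    rw [hf, w']
  · intro h
    have h' := h.rest_comp_rest
    rw [hf, hg] at h'
    refine ⟨⟨e, he, h'⟩, (isInclusion_iff _).2 rfl, hom_ext ?_⟩
    unfold RestrictionCategory.Le at h
    rwa [hf] at h

/-- The intersection of `e` and `d` is the idempotent `e ≫ d`, and on it both sides of the
restriction-category condition are the restrictions of `f` and `g`. -/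
theorem compatible_iff {A : X} {e d : A ⟶ A} {he : rest e = e} {hd : rest d = d} {N : Dom X}
    (f : (⟨A, e, he⟩ : Dom X) ⟶ N) (g : (⟨A, d, hd⟩ : Dom X) ⟶ N) :
    LocalCategory.Compatible f g ↔ RestrictionCategory.Compatible f.val g.val := by
  have hf : rest f.val = e := f.rest_val
  have hg : rest g.val = d := g.rest_val
  have hed : rest (e ≫ d) = e ≫ d := by rw [← he, ← rest_rest_comp, hd]
  have hc : d ≫ e = e ≫ d := by rw [← he, ← hd, rest_comm]
  unfold RestrictionCategory.Compatible
  rw [hf, hg]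
  constructor
  · rintro ⟨_, h⟩
    have h' := congrArg Hom.val (h _ _ (isPullback_toFull ⟨A, d, hd⟩
      (toFull ⟨A, e, he⟩ ≫ eqToHom rfl)))
    have e₁ : (toFull ⟨A, e, he⟩ ≫ eqToHom rfl).val = e := by
      rw [eqToHom_refl, Category.comp_id]; rfl
    have e₂ : (((toFull ⟨A, e, he⟩ ≫ eqToHom rfl).val ≫ d) ≫ g.val : A ⟶ N.base) =
      rest ((toFull ⟨A, e, he⟩ ≫ eqToHom rfl).val ≫ d) ≫ f.val := h'
    have hg' : d ≫ g.val = g.val := g.idem_val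
    have hf' : e ≫ f.val = f.val := f.idem_val
    rw [e₁, hed, Category.assoc, hg', ← hc, Category.assoc, hf'] at e₂
    exact e₂.symm.symm
  · refine fun h => ⟨rfl, fun {P} b a hP => hom_ext ?_⟩
    have w := congrArg Hom.val hP.w
    rw [eqToHom_refl, Category.comp_id] at w
    have w' : b.val = a.val := b.val_idem.symm.trans (w.trans a.val_idem)
    change b.val ≫ g.val = a.val ≫ f.val
    have hb : b.val ≫ d = b.val := b.val_idem
    have ha : a.val ≫ e = a.val := a.val_idem
    rw [w'] at hb ⊢
    calc a.val ≫ g.val = (a.val ≫ e) ≫ g.val := by rw [ha]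
      _ = (a.val ≫ d) ≫ f.val := by rw [Category.assoc, h, Category.assoc]
      _ = a.val ≫ f.val := by rw [hb]

/-- (JL.2) speaks of arbitrary pullbacks, but one with an inclusion as a leg is the explicit one:
the two comparison maps show that `e'` and `rest (g ≫ e)` absorb each other, and commuting
idempotents that do so are equal. -/
theorem pullback_val {A : X} {e : A ⟶ A} {he : rest e = e} {P : Dom X}
    {e' : P.base ⟶ P.base} {he' : rest e' = e'} {g : P ⟶ full A}
    {q : (⟨P.base, e', he'⟩ : Dom X) ⟶ ⟨A, e, he⟩} {π : (⟨P.base, e', he'⟩ : Dom X) ⟶ P}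
    (hπ : π.val = e') (h : IsPullback q π (toFull ⟨A, e, he⟩) g) :
    e' = rest (g.val ≫ e) ∧ q.val = g.val ≫ e := by
  have hc := isPullback_toFull ⟨A, e, he⟩ g
  have h₁ : rest (g.val ≫ e) ≫ e' = rest (g.val ≫ e) := by
    have w : (h.lift _ _ hc.w).val ≫ π.val = rest (g.val ≫ e) :=
      congrArg Hom.val (h.lift_snd _ _ hc.w)
    have i : (h.lift _ _ hc.w).val ≫ e' = (h.lift _ _ hc.w).val := (h.lift _ _ hc.w).val_idem
    rw [hπ, i] at w
    rw [w] at i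
    exact i
  have h₂ : e' ≫ rest (g.val ≫ e) = e' := by
    have w : (hc.lift _ _ h.w).val ≫ rest (g.val ≫ e) = π.val :=
      congrArg Hom.val (hc.lift_snd _ _ h.w)
    have i : (hc.lift _ _ h.w).val ≫ rest (g.val ≫ e) = (hc.lift _ _ h.w).val :=
      (hc.lift _ _ h.w).val_idem
    rw [hπ, i] at w
    rw [w] at i
    exact i
  have h₃ : e' = rest (g.val ≫ e) := by
    rw [← h₂]
    conv_rhs => rw [← h₁]
    rw [← he', rest_comm]
  refine ⟨h₃, ?_⟩
  have w : q.val ≫ e = π.val ≫ g.val := congrArg Hom.val h.w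
  have i : q.val ≫ e = q.val := q.val_idem
  have h₄ : g.val ≫ e = rest (g.val ≫ e) ≫ g.val := by
    conv_lhs => rw [← he, comp_rest]
  exact i.symm.trans (w.trans ((congrArg (· ≫ g.val) (hπ.trans h₃)).trans h₄.symm))

end

variable {X : Type u} [Category.{u} X] [JoinRestrictionCategory X]

open LocalCategory

theorem isJoin_of_val {K N : Dom X} {ι : Type u} {e : ι → (K.base ⟶ K.base)}
    {he : ∀ i, rest (e i) = e i} {f : ∀ i, (⟨K.base, e i, he i⟩ : Dom X) ⟶ N}
    {d : K.base ⟶ K.base} {hd : rest d = d} {s : (⟨K.base, d, hd⟩ : Dom X) ⟶ N}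
    (h : RestrictionCategory.IsJoin (fun i => (f i).val) s.val) : LocalCategory.IsJoin K f s where
  enl_eq := rfl
  le i := (le_iff _ _).2 (h.le i)
  least {T} g hT hg := by
    obtain ⟨t, ht, rfl⟩ := exists_idem hT
    exact (le_iff _ _).2 (h.least _ fun i => (le_iff _ _).1 (hg i))

theorem exists_isJoin_val {K N : Dom X} {ι : Type u} {e : ι → (K.base ⟶ K.base)}
    {he : ∀ i, rest (e i) = e i} (f : ∀ i, (⟨K.base, e i, he i⟩ : Dom X) ⟶ N)
    (hf : ∀ i j, LocalCategory.Compatible (f i) (f j)) :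
    ∃ (d : K.base ⟶ K.base) (hd : rest d = d) (s : (⟨K.base, d, hd⟩ : Dom X) ⟶ N),
      RestrictionCategory.IsJoin (fun i => (f i).val) s.val := by
  have hf' := fun i j => (compatible_iff _ _).1 (hf i j)
  obtain ⟨s, hs⟩ := JoinRestrictionCategory.exists_join (fun i => (f i).val) hf'
  refine ⟨rest s, rest_rest s, ⟨s, rfl, ?_⟩, hs⟩
  -- The join has values in `N`: composing with `N.idem` preserves the join and changes none of the
  -- `f i`.
  have h := JoinRestrictionCategory.join_comp _ _ N.idem hf' hs
  have e₁ : (fun i => (f i).val ≫ N.idem) = fun i => (f i).val := funext fun i => (f i).val_idem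
  rw [e₁] at h
  exact h.unique hs

/-- In the forward direction an upper bound in `X` need not have values in `N`, so leastness in `Dom
X` does not apply to it directly. Compatibility supplies a genuine join of the underlying maps,
which is a morphism of `Dom X`, and antisymmetry identifies `s` with it. -/
theorem isJoin_iff {K N : Dom X} {ι : Type u} {e : ι → (K.base ⟶ K.base)}
    {he : ∀ i, rest (e i) = e i} {f : ∀ i, (⟨K.base, e i, he i⟩ : Dom X) ⟶ N}
    {d : K.base ⟶ K.base} {hd : rest d = d} {s : (⟨K.base, d, hd⟩ : Dom X) ⟶ N}
    (hf : ∀ i j, LocalCategory.Compatible (f i) (f j)) :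
    LocalCategory.IsJoin K f s ↔ RestrictionCategory.IsJoin (fun i => (f i).val) s.val := by
  refine ⟨fun h => ?_, isJoin_of_val⟩
  obtain ⟨d', hd', s', hs'⟩ := exists_isJoin_val f hf
  have h₁ := (le_iff _ _).1 (h.least s' rfl (isJoin_of_val hs').le)
  have h₂ := hs'.least s.val fun i => (le_iff _ _).1 (h.le i)
  rwa [h₁.antisymm h₂]

/-- For (JL.2), the domains `e i` have join `d` because `rest` preserves joins. The underlying maps
of `q i ≫ m i` are `g ≫ e i`, with join `g ≫ d`; those of `π i` are `rest (g ≫ e i)`, with join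
`rest (g ≫ d)`. These are the two legs of the explicit pullback of `d` along `g`. -/
instance : JoinLocalCategory (Dom X) where
  exists_join {K N ι M} f hM hf := by
    obtain ⟨e, he, rfl⟩ := exists_idem_family hM
    obtain ⟨d, hd, s, hs⟩ := exists_isJoin_val f hf
    exact ⟨_, s, isJoin_of_val hs⟩
  pullback_join {K N ι M} f hM hf {S} s hs m hm {P} g Q q π hπ hpb := by
    obtain ⟨e, he, rfl⟩ := exists_idem_family hM
    obtain ⟨d, hd, rfl⟩ := exists_idem hs.enl_eq
    obtain ⟨e', he', rfl⟩ := exists_idem_family (fun i => (hπ i).choose)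
    have hm' := fun i => (isInclusion_iff _).1 (hm i)
    have hπ' := fun i => (isInclusion_iff (π i)).1 (hπ i)
    have hpb' := fun i => by
      have h := hpb i
      rw [eqToHom_refl, Category.comp_id] at h
      exact pullback_val (P := P) (hπ' i) h
    have hs' := (isJoin_iff hf).1 hs
    have hj := hs'.rest
    have e₁ : (fun i => rest (f i).val) = e := funext fun i => (f i).rest_val
    have e₂ : rest s.val = d := s.rest_val
    rw [e₁, e₂] at hj
    have hej : ∀ i j, RestrictionCategory.Compatible (e i) (e j) := fun i j => by
      rw [← he i, ← he j]; exact .rest _ _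
    have hgj := JoinRestrictionCategory.comp_join g.val e d hej hj
    refine ⟨_, pullbackFst ⟨K.base, d, hd⟩ g, pullbackSnd ⟨K.base, d, hd⟩ g, ?_, ?_,
      isPullback_toFull ⟨K.base, d, hd⟩ g⟩
    · refine isJoin_of_val (s := pullbackFst ⟨K.base, d, hd⟩ g) ?_
      have e₃ : (fun i => (q i ≫ m i).val) = fun i => g.val ≫ e i := funext fun i => by
        have h₁ : (q i).val ≫ e i = (q i).val := (q i).val_idem
        calc (q i).val ≫ (m i).val = (q i).val ≫ e i := by rw [hm']
          _ = _ := by rw [h₁, (hpb' i).2]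
      rw [e₃]
      exact hgj
    · refine isJoin_of_val (s := pullbackSnd ⟨K.base, d, hd⟩ g) ?_
      have e₃ : (fun i => (π i).val) = fun i => rest (g.val ≫ e i) := funext fun i => by
        rw [hπ' i, (hpb' i).1]
      rw [e₃]
      exact hgj.rest

end Dom

/-! ### Functoriality of the category of restriction idempotents. -/

namespace Dom

open RestrictionCategory

section

variable {X : Type u} [Category.{v} X] [RestrictionCategory X]
  {Y : Type u} [Category.{v} Y] [RestrictionCategory Y]

/-- The functor on restriction idempotents induced by a restriction functor. -/
def mapFunctor (F : RestrictionFunctor X Y) : Dom X ⥤ Dom Y where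
  obj P := ⟨F.obj P.base, F.map P.idem, by rw [← F.map_rest, P.rest_idem]⟩
  map f := ⟨F.map f.val, (F.map_rest _).symm.trans (congrArg F.map f.rest_val),
    (F.map_comp _ _).symm.trans (congrArg F.map f.val_idem)⟩
  map_id _ := rfl
  map_comp _ _ := hom_ext (F.map_comp _ _)

theorem mapFunctor_full (F : RestrictionFunctor X Y) (A : X) :
    (mapFunctor F).obj (full A) = full (F.obj A) :=
  Dom.ext rfl (heq_of_eq (F.map_id A))

/-- The explicit pullback is given by the formula `rest (f ≫ e)`, which a restriction functor
preserves. Any other pullback is isomorphic to it. -/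
theorem mapFunctor_isPullback (F : RestrictionFunctor X Y) {M N P : Dom X} (f : N ⟶ full M.base)
    (q : P ⟶ M) (m : P ⟶ N) (h : IsPullback q m M.toFull f) :
    IsPullback ((mapFunctor F).map q) ((mapFunctor F).map m) ((mapFunctor F).map M.toFull)
      ((mapFunctor F).map f) := by
  have hc := isPullback_toFull M f
  have hF : IsPullback ((mapFunctor F).map (pullbackFst M f))
      ((mapFunctor F).map (pullbackSnd M f)) ((mapFunctor F).map M.toFull)
      ((mapFunctor F).map f) := by
    refine IsPullback.of_exists_lift (mono_of_val_eq _ rfl) (mono_of_val_eq _ rfl) ?_ ?_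
    · rw [← Functor.map_comp, hc.w, Functor.map_comp]
    · intro T b a w
      have w' : b.val ≫ F.map M.idem = a.val ≫ F.map f.val := congrArg Hom.val w
      have hb : b.val ≫ F.map M.idem = b.val := b.val_idem
      -- Applied to `k = a.val`, this says that `a` has values in the image of the preimage of `M`,
      -- so it is its own lift.
      have key : ∀ k : T.base ⟶ F.obj N.base, k ≫ F.map f.val = b.val →
          k ≫ F.map (rest (f.val ≫ M.idem)) = rest b.val ≫ k := fun k hk => by
        have hk' : k ≫ F.map (f.val ≫ M.idem) = b.val :=
          (congrArg (k ≫ ·) (F.map_comp f.val M.idem)).trans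
            ((Category.assoc k (F.map f.val) (F.map M.idem)).symm.trans
              ((congrArg (· ≫ F.map M.idem) hk).trans hb))
        rw [F.map_rest, comp_rest, hk']
        rfl
      replace key := key a.val (w'.symm.trans hb)
      rw [b.rest_val] at key
      replace key := key.trans a.idem_val
      exact ⟨⟨a.val, a.rest_val, key⟩, hom_ext key⟩
  refine hF.of_iso ((mapFunctor F).mapIso (hc.isoIsPullback _ _ h)) (Iso.refl _) (Iso.refl _)
    (Iso.refl _) ?_ ?_ ?_ ?_
  · rw [Iso.refl_hom, Category.comp_id, Functor.mapIso_hom, ← Functor.map_comp,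
      IsPullback.isoIsPullback_hom_fst]
  · rw [Iso.refl_hom, Category.comp_id, Functor.mapIso_hom, ← Functor.map_comp,
      IsPullback.isoIsPullback_hom_snd]
  · simp
  · simp

end

variable {X : Type u} [Category.{u} X] [JoinRestrictionCategory X]
  {Y : Type u} [Category.{u} Y] [JoinRestrictionCategory Y]

/-- The local functor on restriction idempotents induced by a restriction functor. -/
def mapLocal (F : JoinRestrictionFunctor X Y) : JoinLocalFunctor (Dom X) (Dom Y) where
  toFunctor := mapFunctor F.toRestrictionFunctor
  obj_enl M := mapFunctor_full F.toRestrictionFunctor M.base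
  map_incl M := hom_ext (by
    rw [comp_val, eqToHom_val]
    change F.map M.idem = F.map M.idem ≫ 𝟙 _ ≫ eqToHom rfl
    simp)
  map_isPullback f q m h := mapFunctor_isPullback F.toRestrictionFunctor f q m h
  map_join {K N ι M} f S s hM hf hs := by
    obtain ⟨e, he, rfl⟩ := exists_idem_family hM
    obtain ⟨d, hd, rfl⟩ := exists_idem hs.enl_eq
    exact isJoin_of_val (K := (mapFunctor F.toRestrictionFunctor).obj K)
      (N := (mapFunctor F.toRestrictionFunctor).obj N)
      (e := fun i => F.map (e i)) (he := fun i => (F.map_rest _).symm.trans (congrArg F.map (he i)))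
      (d := F.map d) (hd := (F.map_rest _).symm.trans (congrArg F.map hd))
      (f := fun i => (mapFunctor F.toRestrictionFunctor).map (f i))
      (s := (mapFunctor F.toRestrictionFunctor).map s)
      (F.map_join (fun i => (f i).val) s.val (fun i j => (compatible_iff _ _).1 (hf i j))
        ((isJoin_iff hf).1 hs))

/-- The natural transformation induced by a restriction natural transformation. -/
def mapTransformation {F G : JoinRestrictionFunctor X Y}
    (φ : RestrictionTransformation F.toRestrictionFunctor G.toRestrictionFunctor) :
    NatTrans (mapLocal F).toFunctor (mapLocal G).toFunctor where
  -- The component at an idempotent is `φ` cut down to it. Lax naturality of `φ` at the idempotent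
  -- itself shows that the values lie in `G.map P.idem`.
  app P := ⟨F.map P.idem ≫ φ.app P.base,
    (rest_comp_total (F.map P.idem) _ (φ.total _)).trans
      ((F.map_rest _).symm.trans (congrArg F.map P.rest_idem)),
    (Category.assoc (F.map P.idem) (φ.app P.base) (G.map P.idem)).trans
      (((φ.naturality P.idem).trans (congrArg (fun k => F.map k ≫ φ.app P.base ≫ G.map P.idem)
        P.rest_idem)).symm)⟩
  -- Naturality becomes strict: the correction factor `F.map (rest f.val)` is the idempotent `F.map
  -- P.idem` already present in the component.
  naturality {P Q} f := hom_ext (by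
    change F.map f.val ≫ F.map Q.idem ≫ φ.app Q.base = (F.map P.idem ≫ φ.app P.base) ≫ G.map f.val
    rw [← Category.assoc, ← F.map_comp, f.val_idem, φ.naturality, f.rest_val, Category.assoc])

theorem mapTransformation_ext {F G : JoinRestrictionFunctor X Y}
    {α β : NatTrans (mapLocal F).toFunctor (mapLocal G).toFunctor}
    (h : ∀ P, (α.app P).val = (β.app P).val) : α = β :=
  NatTrans.ext (funext fun P => hom_ext (h P))

end Dom

/-- The 2-functor that sends a join restriction category to the local category of its restriction
idempotents. -/
def domFunctor : StrictPseudofunctor JRCat.{u} JLCat.{u} :=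
  StrictPseudofunctor.mk''
    { obj := fun X => { carrier := Dom X.carrier }
      map := fun F => Dom.mapLocal F
      map₂ := fun φ => Dom.mapTransformation φ
      map₂_id := fun F => Dom.mapTransformation_ext fun P => Category.comp_id _
      map₂_comp := fun {X Y F G H} φ ψ => Dom.mapTransformation_ext fun P => by
        have h : (F.map P.idem ≫ φ.app P.base) ≫ G.map P.idem = F.map P.idem ≫ φ.app P.base :=
          ((Dom.mapTransformation φ).app P).val_idem
        change F.map P.idem ≫ φ.app P.base ≫ ψ.app P.base =
          (F.map P.idem ≫ φ.app P.base) ≫ G.map P.idem ≫ ψ.app P.base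
        rw [← Category.assoc, ← Category.assoc, h]
      map_id := fun _ => rfl
      map_comp := fun _ _ => rfl
      map₂_whisker_left := fun F G H φ => by
        refine Eq.trans ?_ ((Category.id_comp _).trans (Category.comp_id _)).symm
        exact Dom.mapTransformation_ext fun P => rfl
      map₂_whisker_right := fun {X Y Z F G} φ H => by
        refine Eq.trans ?_ ((Category.id_comp _).trans (Category.comp_id _)).symm
        exact Dom.mapTransformation_ext fun P => (H.map_comp _ _).symm }

/-! ### Local categories: inclusions and covers -/

theorem CategoryTheory.IsPullback.comp_mono {C : Type u} [Category.{v} C] {P M N K L : C}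
    {q : P ⟶ M} {n : P ⟶ N} {m : M ⟶ K} {g : N ⟶ K} (j : K ⟶ L) [Mono j]
    (h : IsPullback q n m g) : IsPullback q n (m ≫ j) (g ≫ j) :=
  ⟨⟨by rw [← Category.assoc, h.w, Category.assoc]⟩,
    ⟨Limits.PullbackCone.IsLimit.mk _
      (fun s => h.lift s.fst s.snd ((cancel_mono j).1 (by simpa using s.condition)))
      (fun s => h.lift_fst _ _ _) (fun s => h.lift_snd _ _ _)
      (fun s u hu hv => h.hom_ext (by simpa using hu) (by simpa using hv))⟩⟩

theorem CategoryTheory.IsPullback.of_comp_mono {C : Type u} [Category.{v} C] {P M N K L : C}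
    {q : P ⟶ M} {n : P ⟶ N} {m : M ⟶ K} {g : N ⟶ K} (j : K ⟶ L) [Mono j]
    (h : IsPullback q n (m ≫ j) (g ≫ j)) : IsPullback q n m g :=
  have w : q ≫ m = n ≫ g := (cancel_mono j).1 (by simpa using h.w)
  ⟨⟨w⟩,
    ⟨Limits.PullbackCone.IsLimit.mk _
      (fun s => h.lift s.fst s.snd (by rw [← Category.assoc, s.condition, Category.assoc]))
      (fun s => h.lift_fst _ _ _) (fun s => h.lift_snd _ _ _)
      (fun s u hu hv => h.hom_ext (by simpa using hu) (by simpa using hv))⟩⟩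

namespace LocalCategory

section

variable {C : Type u} [Category.{v} C] [LocalCategory C]

attribute [instance] mono_incl

theorem IsInclusion.enl_eq {M N : C} {m : M ⟶ N} (h : IsInclusion m) : enl M = enl N := h.choose

theorem IsInclusion.w {M N : C} {m : M ⟶ N} (h : IsInclusion m) :
    m ≫ incl N ≫ eqToHom h.enl_eq.symm = incl M := by
  rw [← Category.assoc, h.choose_spec]
  simp

theorem IsInclusion.eqToHom {M N : C} (h : M = N) : IsInclusion (eqToHom h) := by
  subst h
  exact ⟨rfl, by simp⟩

theorem IsInclusion.id (M : C) : IsInclusion (𝟙 M) := .eqToHom rfl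

theorem IsInclusion.comp {M N P : C} {m : M ⟶ N} {n : N ⟶ P} (hm : IsInclusion m)
    (hn : IsInclusion n) : IsInclusion (m ≫ n) := by
  obtain ⟨h, w⟩ := hm
  obtain ⟨h', w'⟩ := hn
  exact ⟨h.trans h', by rw [Category.assoc, w', ← Category.assoc, w]; simp⟩

theorem IsInclusion.of_comp {M N P : C} {m : M ⟶ N} {n : N ⟶ P} (hn : IsInclusion n)
    (hmn : IsInclusion (m ≫ n)) : IsInclusion m := by
  obtain ⟨h, w⟩ := hmn
  obtain ⟨h', w'⟩ := hn
  refine ⟨h.trans h'.symm, ?_⟩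
  rw [← cancel_mono (CategoryTheory.eqToHom h'), Category.assoc, ← w', ← Category.assoc, w]
  simp

theorem IsInclusion.unique {M N : C} {m n : M ⟶ N} (hm : IsInclusion m) (hn : IsInclusion n) :
    m = n := by
  obtain ⟨h, w⟩ := hm
  obtain ⟨h', w'⟩ := hn
  rw [← cancel_mono (incl N), w, w']

theorem IsInclusion.mono {M N : C} {m : M ⟶ N} (hm : IsInclusion m) : Mono m :=
  have : Mono (m ≫ incl N ≫ CategoryTheory.eqToHom hm.enl_eq.symm) := by
    rw [hm.w]; infer_instance
  mono_of_mono m (incl N ≫ CategoryTheory.eqToHom hm.enl_eq.symm)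

theorem IsInclusion.inv {M N : C} {m : M ⟶ N} [IsIso m] (hm : IsInclusion m) :
    IsInclusion (CategoryTheory.inv m) :=
  .of_comp hm (by rw [IsIso.inv_hom_id]; exact .id _)

theorem IsInclusion.isIso {M N : C} {m : M ⟶ N} {n : N ⟶ M} (hm : IsInclusion m)
    (hn : IsInclusion n) : IsIso m :=
  ⟨n, (hm.comp hn).unique (.id _), (hn.comp hm).unique (.id _)⟩

theorem isInclusion_incl (M : C) : IsInclusion (incl M) :=
  ⟨(enl_enl M).symm, by rw [incl_enl]⟩

theorem exists_isInclusion {M K : C} (h : enl M = enl K) (hK : enl K = K) :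
    ∃ m : M ⟶ K, IsInclusion m :=
  ⟨incl M ≫ eqToHom (h.trans hK), (isInclusion_incl M).comp (.eqToHom _)⟩

/-- Followed by the monic maximal inclusion of `K`, the map `m` becomes the maximal inclusion of
`M`. That one has pullbacks, and the monic can be cancelled. -/
theorem exists_pullback_inclusion {M K N : C} {m : M ⟶ K} (hm : IsInclusion m) (g : N ⟶ K) :
    ∃ (P : C) (q : P ⟶ M) (n : P ⟶ N), IsPullback q n m g ∧ IsInclusion n := by
  obtain ⟨P, q, n, h, hn⟩ := exists_pullback (g ≫ incl K ≫ eqToHom hm.enl_eq.symm)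
  refine ⟨P, q, n, .of_comp_mono (incl K ≫ eqToHom hm.enl_eq.symm) ?_, hn⟩
  rwa [hm.w]

/-- Agreement on the pullback means agreement on all generalized elements of it, and the elements
are the same whether the pullback is formed over the enlargement or over any common `K`. -/
theorem compatible_iff {K A B N : C} {m : A ⟶ K} {n : B ⟶ K} (hm : IsInclusion m)
    (hn : IsInclusion n) (f : A ⟶ N) (g : B ⟶ N) :
    Compatible f g ↔ ∀ {T : C} (a : T ⟶ A) (b : T ⟶ B), a ≫ m = b ≫ n → a ≫ f = b ≫ g := by
  constructor
  · rintro ⟨h, H⟩ T a b w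
    obtain ⟨P, q, p, hP, -⟩ := exists_pullback_inclusion hn m
    have e := H q p (by
      have e₁ : m ≫ incl K ≫ eqToHom hn.enl_eq.symm = incl A ≫ eqToHom h := by
        rw [← hm.w]; simp
      rw [← hn.w, ← e₁]
      exact hP.comp_mono _)
    rw [← hP.lift_fst b a w.symm, Category.assoc, e, ← Category.assoc, hP.lift_snd]
  · refine fun H => ⟨hm.enl_eq.trans hn.enl_eq.symm, fun b a hP => (H a b ?_).symm⟩
    have w := hP.w
    rw [← hm.w, ← hn.w] at w
    rw [← cancel_mono (incl K ≫ eqToHom hn.enl_eq.symm)]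
    simpa using w.symm

/-- A family of inclusions into `S` covers `S` when it factors through no smaller subobject. -/
structure IsCover {S : C} {ι : Type*} {M : ι → C} (m : ∀ i, M i ⟶ S) : Prop where
  isInclusion : ∀ i, IsInclusion (m i)
  isIso : ∀ {Z : C} (z : Z ⟶ S), IsInclusion z → (∀ i, ∃ k : M i ⟶ Z, k ≫ z = m i) → IsIso z

/-- If all `M i` factor through an inclusion `z : Z ⟶ S`, then `z ≫ s` is again an upper bound.
Leastness gives an inclusion `S ⟶ Z`, and inclusions in both directions are mutually inverse. -/
theorem IsJoin.isCover {K N S : C} {ι : Type (max u v)} {M : ι → C} {f : ∀ i, M i ⟶ N}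
    {s : S ⟶ N} (h : IsJoin K f s) {m : ∀ i, M i ⟶ S} (hm : ∀ i, IsInclusion (m i)) :
    IsCover m where
  isInclusion := hm
  isIso {Z} z hz H := by
    obtain ⟨n, hn, -⟩ := h.least (z ≫ s) (hz.enl_eq.trans h.enl_eq) fun i => by
      obtain ⟨k, hk⟩ := H i
      obtain ⟨m', hm', w⟩ := h.le i
      refine ⟨k, .of_comp hz (hk ▸ hm i), ?_⟩
      rw [← Category.assoc, hk, (hm i).unique hm', w]
    exact hz.isIso hn

end

variable {C : Type u} [Category.{v} C] [JoinLocalCategory C]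

/-- The restrictions of `h` are compatible, so they have a join with some domain `Z`. As `h` is an
upper bound, `Z` is included in `S`, and it contains every `M i`, so the cover condition makes `Z ⟶
S` an isomorphism. -/
theorem IsCover.isJoin {K S N : C} {ι : Type (max u v)} {M : ι → C} {m : ∀ i, M i ⟶ S}
    (hm : IsCover m) (hK : enl S = enl K) (h : S ⟶ N) : IsJoin K (fun i => m i ≫ h) h where
  enl_eq := hK
  le i := ⟨m i, hm.isInclusion i, rfl⟩
  least {T} g hT H := by
    obtain ⟨Z, z, hz⟩ := JoinLocalCategory.exists_join (K := K) (fun i => m i ≫ h)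
      (fun i => (hm.isInclusion i).enl_eq.trans hK)
      (fun i j => (compatible_iff (hm.isInclusion i) (hm.isInclusion j) _ _).2 fun a b w => by
        rw [← Category.assoc, w, Category.assoc])
    obtain ⟨n, hn, w⟩ := hz.least h hK fun i => ⟨m i, hm.isInclusion i, rfl⟩
    have := hm.isIso n hn fun i => by
      obtain ⟨k, hk, -⟩ := hz.le i
      exact ⟨k, (hk.comp hn).unique (hm.isInclusion i)⟩
    obtain ⟨l, hl, w'⟩ := hz.least g hT H
    exact ⟨inv n ≫ l, hn.inv.comp hl, by rw [Category.assoc, w', ← w, IsIso.inv_hom_id_assoc]⟩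

/-- The identity of `S` is the join of the `m i`, so (JL.2) applies to `g ≫ incl S`. It yields the
join `b : W ⟶ P` of the `π i`, and since `g` already lands in `S`, the pullback property gives `b` a
section. A subobject `z` through which all `Q i` factor receives `W`, so the monic `z` is split epi.
-/
theorem IsCover.pullback {S P : C} {ι : Type (max u v)} {M Q : ι → C} {m : ∀ i, M i ⟶ S}
    (hm : IsCover m) (g : P ⟶ S) {q : ∀ i, Q i ⟶ M i} {π : ∀ i, Q i ⟶ P}
    (hπ : ∀ i, IsInclusion (π i)) (h : ∀ i, IsPullback (q i) (π i) (m i) (g)) : IsCover π where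
  isInclusion := hπ
  isIso {Z} z hz H := by
    have hj := hm.isJoin rfl (𝟙 S)
    obtain ⟨W, a, b, -, hb, hab⟩ := JoinLocalCategory.pullback_join _
      (fun i => (hm.isInclusion i).enl_eq)
      (fun i j => (compatible_iff (hm.isInclusion i) (hm.isInclusion j) _ _).2 fun a b w => by
        rw [← Category.assoc, w, Category.assoc]) _ hj m hm.isInclusion (g ≫ incl S) Q q π hπ
      (fun i => by
        rw [← (hm.isInclusion i).w, Category.assoc]
        exact (h i).comp_mono _)
    obtain ⟨l, hl, w⟩ := hb.least z hz.enl_eq fun i => by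
      obtain ⟨k, hk⟩ := H i
      exact ⟨k, .of_comp hz (hk ▸ hπ i), hk⟩
    have := hz.mono
    have e : (hab.lift g (𝟙 P) (Category.id_comp _).symm ≫ l) ≫ z = 𝟙 P := by
      rw [Category.assoc, w, hab.lift_snd]
    have : IsSplitEpi z := ⟨⟨_, e⟩⟩
    exact isIso_of_mono_of_isSplitEpi z

end LocalCategory

/-! ### The restriction category of partial maps -/

open LocalCategory

/-- The objects of a local category that are their own enlargement. -/
@[ext]
structure Enlarged (C : Type u) [Category.{v} C] [LocalCategory C] where
  obj : C
  enl_obj : LocalCategory.enl obj = obj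

/-- A partial map from `K` to `N`, encoded by the relation between generalized elements that it
defines. It is represented by an inclusion `m : M ⟶ K` and a morphism `f : M ⟶ N`. -/
@[ext]
structure PartialMap {C : Type u} [Category.{v} C] [LocalCategory C] (K N : Enlarged C) where
  rel : ∀ T : C, (T ⟶ K.obj) → (T ⟶ N.obj) → Prop
  exists_rep : ∃ (M : C) (m : M ⟶ K.obj) (f : M ⟶ N.obj), IsInclusion m ∧
    ∀ T t x, rel T t x ↔ ∃ u : T ⟶ M, u ≫ m = t ∧ u ≫ f = x

namespace PartialMap

section

variable {C : Type u} [Category.{v} C] [LocalCategory C]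

/-- The partial map `R` is represented by the inclusion `m` and the morphism `f`. -/
def Rep {K N : Enlarged C} (R : PartialMap K N) {M : C} (m : M ⟶ K.obj) (f : M ⟶ N.obj) : Prop :=
  IsInclusion m ∧ ∀ T t x, R.rel T t x ↔ ∃ u : T ⟶ M, u ≫ m = t ∧ u ≫ f = x

theorem functional {K N : Enlarged C} (R : PartialMap K N) {T : C} {t : T ⟶ K.obj}
    {x y : T ⟶ N.obj} (hx : R.rel T t x) (hy : R.rel T t y) : x = y := by
  obtain ⟨M, m, f, hm, h⟩ := R.exists_rep
  obtain ⟨u, hu, rfl⟩ := (h _ _ _).1 hx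
  obtain ⟨v, hv, rfl⟩ := (h _ _ _).1 hy
  have := hm.mono
  rw [← hv, cancel_mono] at hu
  rw [hu]

theorem rel_comp {K N : Enlarged C} (R : PartialMap K N) {T T' : C} (w : T' ⟶ T) {t : T ⟶ K.obj}
    {x : T ⟶ N.obj} (hx : R.rel T t x) : R.rel T' (w ≫ t) (w ≫ x) := by
  obtain ⟨M, m, f, hm, h⟩ := R.exists_rep
  obtain ⟨u, rfl, rfl⟩ := (h _ _ _).1 hx
  exact (h _ _ _).2 ⟨w ≫ u, Category.assoc _ _ _, Category.assoc _ _ _⟩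

/-- The partial map represented by an inclusion and a morphism. -/
def ofRep {K N : Enlarged C} {M : C} (m : M ⟶ K.obj) (f : M ⟶ N.obj) (hm : IsInclusion m) :
    PartialMap K N :=
  ⟨fun T t x => ∃ u : T ⟶ M, u ≫ m = t ∧ u ≫ f = x, M, m, f, hm, fun _ _ _ => Iff.rfl⟩

theorem rep_ofRep {K N : Enlarged C} {M : C} (m : M ⟶ K.obj) (f : M ⟶ N.obj)
    (hm : IsInclusion m) : (ofRep m f hm).Rep m f := ⟨hm, fun _ _ _ => Iff.rfl⟩

theorem Rep.rel {K N : Enlarged C} {R : PartialMap K N} {M : C} {m : M ⟶ K.obj}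
    {f : M ⟶ N.obj} (h : R.Rep m f) : R.rel M m f := (h.2 _ _ _).2 ⟨𝟙 M, by simp⟩

/-- The composite of relations. -/
def comp {K N P : Enlarged C} (R : PartialMap K N) (S : PartialMap N P) : PartialMap K P where
  rel T t z := ∃ y, R.rel T t y ∧ S.rel T y z
  exists_rep := by
    obtain ⟨M, m, f, hm, h⟩ := R.exists_rep
    obtain ⟨M', m', f', hm', h'⟩ := S.exists_rep
    -- The domain of the composite is the preimage under `f` of the domain of the second partial
    -- map.
    obtain ⟨Q, q, n, hQ, hn⟩ := exists_pullback_inclusion hm' f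
    refine ⟨Q, n ≫ m, q ≫ f', hn.comp hm, fun T t x => ⟨?_, ?_⟩⟩
    · rintro ⟨y, hy, hx⟩
      obtain ⟨a, rfl, rfl⟩ := (h _ _ _).1 hy
      obtain ⟨b, w, rfl⟩ := (h' _ _ _).1 hx
      exact ⟨hQ.lift b a w, by rw [hQ.lift_snd_assoc], by rw [hQ.lift_fst_assoc]⟩
    · rintro ⟨u, rfl, rfl⟩
      refine ⟨u ≫ n ≫ f, (h _ _ _).2 ⟨u ≫ n, by simp⟩, (h' _ _ _).2 ⟨u ≫ q, ?_, by simp⟩⟩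
      rw [Category.assoc, hQ.w]

/-- A morphism, as a partial map that is defined everywhere. -/
def graph {K N : Enlarged C} (f : K.obj ⟶ N.obj) : PartialMap K N where
  rel _ t x := t ≫ f = x
  exists_rep := ⟨_, 𝟙 _, f, .id _, fun _ _ _ => by simp⟩

instance : Category.{max u v} (Enlarged C) where
  Hom K N := PartialMap K N
  id K := graph (𝟙 K.obj)
  comp := comp
  id_comp R := by
    ext T t x
    simp [comp, graph]
  comp_id R := by
    ext T t x
    simp [comp, graph]
  assoc R S U := by
    ext T t x
    constructor
    · rintro ⟨z, ⟨y, h₁, h₂⟩, h₃⟩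
      exact ⟨y, h₁, z, h₂, h₃⟩
    · rintro ⟨y, h₁, z, h₂, h₃⟩
      exact ⟨z, ⟨y, h₁, h₂⟩, h₃⟩

theorem hom_ext {K N : Enlarged C} {R S : K ⟶ N} (h : ∀ T t x, R.rel T t x ↔ S.rel T t x) :
    R = S :=
  PartialMap.ext (by ext T t x; exact h T t x)

theorem rel_id {K : Enlarged C} {T : C} {t x : T ⟶ K.obj} :
    PartialMap.rel (𝟙 K) T t x ↔ t = x := by
  change t ≫ 𝟙 _ = x ↔ _
  rw [Category.comp_id]

/-- The restriction of `R` is the identity relation on the elements where `R` is defined; a span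
`(m, f)` is replaced by `(m, m)`. The axioms are then plain logic about relations, except that
`comp_rest` also needs `R` to be single-valued. -/
instance : RestrictionCategory (Enlarged C) where
  rest {K N} R := (⟨fun T t x => t = x ∧ ∃ y, PartialMap.rel R T t y, by
    obtain ⟨M, m, f, hm, h⟩ := PartialMap.exists_rep R
    refine ⟨M, m, m, hm, fun T t x => ⟨?_, ?_⟩⟩
    · rintro ⟨rfl, y, hy⟩
      obtain ⟨u, hu, -⟩ := (h _ _ _).1 hy
      exact ⟨u, hu, hu⟩
    · rintro ⟨u, hu, rfl⟩
      exact ⟨hu.symm, u ≫ f, (h _ _ _).2 ⟨u, hu, rfl⟩⟩⟩ : PartialMap K K)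
  rest_comp R := hom_ext fun T t x =>
    ⟨by rintro ⟨y, ⟨rfl, -⟩, h⟩; exact h, fun h => ⟨t, ⟨rfl, x, h⟩, h⟩⟩
  rest_comm R S := hom_ext fun T t x =>
    ⟨by rintro ⟨y, ⟨rfl, h⟩, ⟨rfl, h'⟩⟩; exact ⟨t, ⟨rfl, h'⟩, ⟨rfl, h⟩⟩,
      by rintro ⟨y, ⟨rfl, h⟩, ⟨rfl, h'⟩⟩; exact ⟨t, ⟨rfl, h'⟩, ⟨rfl, h⟩⟩⟩
  rest_rest_comp R S := hom_ext fun T t x =>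
    ⟨by rintro ⟨y, ⟨rfl, h⟩, ⟨rfl, z, h'⟩⟩; exact ⟨rfl, z, t, ⟨rfl, h⟩, h'⟩,
      by rintro ⟨rfl, z, y, ⟨rfl, h⟩, h'⟩; exact ⟨t, ⟨rfl, h⟩, rfl, z, h'⟩⟩
  comp_rest R S := hom_ext fun T t x => by
    constructor
    · rintro ⟨y, h, ⟨rfl, z, h'⟩⟩
      exact ⟨t, ⟨rfl, z, y, h, h'⟩, h⟩
    · rintro ⟨y, ⟨rfl, z, w, h, h'⟩, h''⟩
      obtain rfl := PartialMap.functional R h h''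
      exact ⟨w, h, rfl, z, h'⟩

theorem rel_rest {K N : Enlarged C} {R : K ⟶ N} {T : C} {t x : T ⟶ K.obj} :
    PartialMap.rel (RestrictionCategory.rest R) T t x ↔ t = x ∧ ∃ y, R.rel T t y := Iff.rfl

theorem rel_rest_comp {K N P : Enlarged C} {R : K ⟶ N} {S : K ⟶ P} {T : C} {t : T ⟶ K.obj}
    {x : T ⟶ P.obj} : PartialMap.rel (RestrictionCategory.rest R ≫ S) T t x ↔
      (∃ y, R.rel T t y) ∧ S.rel T t x :=
  ⟨by rintro ⟨y, ⟨rfl, h⟩, h'⟩; exact ⟨h, h'⟩, fun ⟨h, h'⟩ => ⟨t, ⟨rfl, h⟩, h'⟩⟩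

theorem le_iff {K N : Enlarged C} {R S : K ⟶ N} :
    RestrictionCategory.Le R S ↔ ∀ T t x, R.rel T t x → S.rel T t x := by
  constructor
  · intro h T t x hx
    rw [← h] at hx
    exact (rel_rest_comp.1 hx).2
  · refine fun h => hom_ext fun T t x => rel_rest_comp.trans ⟨?_, fun hx => ⟨⟨x, hx⟩, h _ _ _ hx⟩⟩
    rintro ⟨⟨y, hy⟩, hx⟩
    rwa [S.functional hx (h _ _ _ hy)]

/-- A Yoneda argument: inclusion of relations is tested on the generic element `(m, f)` of `R`, and
the witness that it belongs to `S` is the required inclusion of domains. -/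
theorem Rep.le_iff {K N : Enlarged C} {R S : K ⟶ N} {A B : C} {m : A ⟶ K.obj} {f : A ⟶ N.obj}
    {n : B ⟶ K.obj} {g : B ⟶ N.obj} (hR : PartialMap.Rep R m f) (hS : PartialMap.Rep S n g) :
    RestrictionCategory.Le R S ↔ Le f g := by
  rw [PartialMap.le_iff]
  constructor
  · intro h
    obtain ⟨u, hu, hu'⟩ := (hS.2 _ _ _).1 (h _ _ _ hR.rel)
    exact ⟨u, .of_comp hS.1 (hu ▸ hR.1), hu'⟩
  · rintro ⟨u, hu, rfl⟩ T t x hx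
    obtain ⟨v, rfl, rfl⟩ := (hR.2 _ _ _).1 hx
    refine (hS.2 _ _ _).2 ⟨v ≫ u, ?_, Category.assoc _ _ _⟩
    rw [Category.assoc, (hu.comp hS.1).unique hR.1]

theorem Rep.compatible_iff {K N : Enlarged C} {R S : K ⟶ N} {A B : C} {m : A ⟶ K.obj}
    {f : A ⟶ N.obj} {n : B ⟶ K.obj} {g : B ⟶ N.obj} (hR : PartialMap.Rep R m f)
    (hS : PartialMap.Rep S n g) :
    RestrictionCategory.Compatible R S ↔ Compatible f g := by
  rw [LocalCategory.compatible_iff hR.1 hS.1]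
  constructor
  · intro h T a b w
    have h₁ : R.rel T (a ≫ m) (a ≫ f) := R.rel_comp a hR.rel
    have h₂ : S.rel T (a ≫ m) (b ≫ g) := w ▸ S.rel_comp b hS.rel
    have h₃ : PartialMap.rel (RestrictionCategory.rest R ≫ S) T (a ≫ m) (b ≫ g) :=
      rel_rest_comp.2 ⟨⟨_, h₁⟩, h₂⟩
    rw [h] at h₃
    exact R.functional h₁ (rel_rest_comp.1 h₃).2
  · intro h
    -- Compatibility amounts to the two relations never assigning different values to the same
    -- element.
    have key : ∀ T t x y, R.rel T t x → S.rel T t y → x = y := by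
      intro T t x y hx hy
      obtain ⟨a, rfl, rfl⟩ := (hR.2 _ _ _).1 hx
      obtain ⟨b, w, rfl⟩ := (hS.2 _ _ _).1 hy
      exact h a b w.symm
    refine hom_ext fun T t x => rel_rest_comp.trans (Iff.trans ?_ rel_rest_comp.symm)
    constructor
    · rintro ⟨⟨y, hy⟩, hx⟩
      exact ⟨⟨x, hx⟩, key _ _ _ _ hy hx ▸ hy⟩
    · rintro ⟨⟨y, hy⟩, hx⟩
      exact ⟨⟨x, hx⟩, key _ _ _ _ hx hy ▸ hy⟩

end

/-! ### Joins of partial maps. -/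

section

variable {C : Type u} [Category.{u} C] [LocalCategory C]

/-- Both notions have the same upper bounds: as `K` is its own enlargement, any object with that
enlargement is included in `K`, so every competitor on one side represents one on the other. -/
theorem isJoin_iff {K N : Enlarged C} {ι : Type u} {R : ι → (K ⟶ N)} {S : K ⟶ N} {M : ι → C}
    {m : ∀ i, M i ⟶ K.obj} {f : ∀ i, M i ⟶ N.obj} {D : C} {n : D ⟶ K.obj} {s : D ⟶ N.obj}
    (hR : ∀ i, PartialMap.Rep (R i) (m i) (f i)) (hS : PartialMap.Rep S n s) :
    RestrictionCategory.IsJoin R S ↔ IsJoin K.obj f s := by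
  constructor
  · intro h
    refine ⟨hS.1.enl_eq, fun i => ((hR i).le_iff hS).1 (h.le i), fun {T} g hT H => ?_⟩
    obtain ⟨p, hp⟩ := exists_isInclusion hT K.enl_obj
    have hG := rep_ofRep p g hp
    exact (hS.le_iff hG).1 (h.least _ fun i => ((hR i).le_iff hG).2 (H i))
  · intro h
    refine ⟨fun i => ((hR i).le_iff hS).2 (h.le i), fun G H => ?_⟩
    obtain ⟨T, p, g, hG⟩ := PartialMap.exists_rep G
    exact (hS.le_iff hG).2 (h.least _ hG.1.enl_eq fun i => ((hR i).le_iff hG).1 (H i))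

end

variable {C : Type u} [Category.{u} C] [JoinLocalCategory C]

/-- A partial map on `W` is the join of its restrictions to the preimages of a cover. -/
theorem isJoin_of_isCover {K N : Enlarged C} {ι : Type u} {S W : C} {M : ι → C}
    {m : ∀ i, M i ⟶ S} (hm : IsCover m) (b : W ⟶ S) {R : ι → (K ⟶ N)} {G : K ⟶ N}
    {n : W ⟶ K.obj} {g : W ⟶ N.obj} (hG : PartialMap.Rep G n g)
    (hR : ∀ i T t x, (R i).rel T t x ↔
      ∃ u : T ⟶ W, (u ≫ n = t ∧ u ≫ g = x) ∧ ∃ v : T ⟶ M i, v ≫ m i = u ≫ b) :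
    RestrictionCategory.IsJoin R G := by
  choose Q q π hQ hπ using fun i => exists_pullback_inclusion (hm.isInclusion i) b
  -- The preimages `Q i` of the `M i` along `b` cover `W`, so `g` is the join of its restrictions to
  -- them; these restrictions represent the `R i`.
  refine (isJoin_iff (m := fun i => π i ≫ n) (f := fun i => π i ≫ g) (fun i => ⟨(hπ i).comp hG.1,
    fun T t x => (hR i T t x).trans ⟨?_, ?_⟩⟩) hG).2 ((hm.pullback b hπ hQ).isJoin hG.1.enl_eq g)
  · rintro ⟨u, ⟨rfl, rfl⟩, v, hv⟩
    exact ⟨(hQ i).lift v u hv, by rw [(hQ i).lift_snd_assoc], by rw [(hQ i).lift_snd_assoc]⟩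
  · rintro ⟨u, rfl, rfl⟩
    exact ⟨u ≫ π i, by simp, u ≫ q i, by rw [Category.assoc, (hQ i).w, Category.assoc]⟩

/-- Representatives of a compatible family and of its join. -/
theorem exists_isCover {K N : Enlarged C} {ι : Type u} {R : ι → (K ⟶ N)} {G : K ⟶ N}
    (h : RestrictionCategory.IsJoin R G) :
    ∃ (S : C) (n : S ⟶ K.obj) (s : S ⟶ N.obj) (M : ι → C) (m : ∀ i, M i ⟶ S),
      PartialMap.Rep G n s ∧ IsCover m ∧ ∀ i, PartialMap.Rep (R i) (m i ≫ n) (m i ≫ s) := by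
  choose M m f hR using fun i => PartialMap.exists_rep (R i)
  obtain ⟨S, n, s, hG⟩ := PartialMap.exists_rep G
  have hj := (isJoin_iff hR hG).1 h
  choose k hk hk' using hj.le
  refine ⟨S, n, s, M, k, hG, hj.isCover hk, fun i => ?_⟩
  rw [hk' i, ((hk i).comp hG.1).unique (hR i).1]
  exact hR i

/-- For stability, let `D` be the domain of the join, covered by the `M i`, and `W` the domain of
the composite. In both cases `W` has a map to `D` (`a` for precomposition, `b` for postcomposition),
and the composites with the individual members of the family are the restrictions of the whole
composite to the preimages of the `M i`. -/
instance : JoinRestrictionCategory (Enlarged C) where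
  exists_join {K N ι} R h := by
    choose M m f hR using fun i => PartialMap.exists_rep (R i)
    obtain ⟨S, s, hs⟩ := JoinLocalCategory.exists_join (K := K.obj) f (fun i => (hR i).1.enl_eq)
      (fun i j => (Rep.compatible_iff (hR i) (hR j)).1 (h i j))
    obtain ⟨n, hn⟩ := exists_isInclusion hs.enl_eq K.enl_obj
    exact ⟨ofRep n s hn, (isJoin_iff hR (rep_ofRep n s hn)).2 hs⟩
  comp_join {K N L ι} G R S _ h := by
    obtain ⟨D, n, s, M, m, hS, hm, hR⟩ := exists_isCover h
    obtain ⟨P, p, g, hp, hG⟩ := PartialMap.exists_rep G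
    obtain ⟨W, a, b, hW, hb⟩ := exists_pullback_inclusion hS.1 g
    have := hS.1.mono
    refine isJoin_of_isCover hm a (n := b ≫ p) (g := a ≫ s) ⟨hb.comp hp, fun T t x => ⟨?_, ?_⟩⟩
      fun i T t x => ⟨?_, ?_⟩
    · rintro ⟨y, hy, hx⟩
      obtain ⟨u, rfl, rfl⟩ := (hG _ _ _).1 hy
      obtain ⟨v, w, rfl⟩ := (hS.2 _ _ _).1 hx
      exact ⟨hW.lift v u w, by rw [hW.lift_snd_assoc], by rw [hW.lift_fst_assoc]⟩
    · rintro ⟨u, rfl, rfl⟩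
      refine ⟨u ≫ b ≫ g, (hG _ _ _).2 ⟨u ≫ b, by simp⟩, (hS.2 _ _ _).2 ⟨u ≫ a, ?_, by simp⟩⟩
      rw [Category.assoc, hW.w]
    · rintro ⟨y, hy, hx⟩
      obtain ⟨u, rfl, rfl⟩ := (hG _ _ _).1 hy
      obtain ⟨v, w, rfl⟩ := ((hR i).2 _ _ _).1 hx
      refine ⟨hW.lift (v ≫ m i) u (by rw [Category.assoc, w]), ⟨by rw [hW.lift_snd_assoc], ?_⟩,
        v, by rw [hW.lift_fst]⟩
      rw [hW.lift_fst_assoc, Category.assoc]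
    · rintro ⟨u, ⟨rfl, rfl⟩, v, hv⟩
      refine ⟨u ≫ b ≫ g, (hG _ _ _).2 ⟨u ≫ b, by simp⟩, ((hR i).2 _ _ _).2 ⟨v, ?_, ?_⟩⟩
      · rw [← Category.assoc, hv, Category.assoc, hW.w]
      · rw [← Category.assoc, hv, Category.assoc]
  join_comp {K N L ι} R S H _ h := by
    obtain ⟨D, n, s, M, m, hS, hm, hR⟩ := exists_isCover h
    obtain ⟨V, p, g, hp, hH⟩ := PartialMap.exists_rep H
    obtain ⟨W, a, b, hW, hb⟩ := exists_pullback_inclusion hp s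
    have := hS.1.mono
    refine isJoin_of_isCover hm b (n := b ≫ n) (g := a ≫ g) ⟨hb.comp hS.1, fun T t x => ⟨?_, ?_⟩⟩
      fun i T t x => ⟨?_, ?_⟩
    · rintro ⟨y, hy, hx⟩
      obtain ⟨u, rfl, rfl⟩ := (hS.2 _ _ _).1 hy
      obtain ⟨v, w, rfl⟩ := (hH _ _ _).1 hx
      exact ⟨hW.lift v u w, by rw [hW.lift_snd_assoc], by rw [hW.lift_fst_assoc]⟩
    · rintro ⟨u, rfl, rfl⟩
      refine ⟨u ≫ b ≫ s, (hS.2 _ _ _).2 ⟨u ≫ b, by simp⟩, (hH _ _ _).2 ⟨u ≫ a, ?_, by simp⟩⟩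
      rw [Category.assoc, hW.w]
    · rintro ⟨y, hy, hx⟩
      obtain ⟨u, rfl, rfl⟩ := ((hR i).2 _ _ _).1 hy
      obtain ⟨v, w, rfl⟩ := (hH _ _ _).1 hx
      refine ⟨hW.lift v (u ≫ m i) (by rw [w, Category.assoc]), ⟨?_, by rw [hW.lift_fst_assoc]⟩,
        u, by rw [hW.lift_snd]⟩
      rw [hW.lift_snd_assoc, Category.assoc]
    · rintro ⟨u, ⟨rfl, rfl⟩, v, hv⟩
      refine ⟨u ≫ b ≫ s, ((hR i).2 _ _ _).2 ⟨v, ?_, ?_⟩, (hH _ _ _).2 ⟨u ≫ a, ?_, by simp⟩⟩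
      · rw [← Category.assoc, hv, Category.assoc]
      · rw [← Category.assoc, hv, Category.assoc]
      · rw [Category.assoc, hW.w]

end PartialMap

/-! ### Action of local functors and natural transformations on partial maps. -/

namespace LocalFunctor

variable {C : Type u} [Category.{v} C] [LocalCategory C]
  {D : Type u} [Category.{v} D] [LocalCategory D]

theorem map_isInclusion (F : LocalFunctor C D) {M N : C} {m : M ⟶ N} (hm : IsInclusion m) :
    IsInclusion (F.map m) := by
  obtain ⟨h, w⟩ := hm
  refine ⟨by rw [← F.obj_enl, ← F.obj_enl, h], ?_⟩
  have w' := congrArg F.map w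
  rw [F.map_comp, F.map_incl, F.map_comp, F.map_incl, eqToHom_map] at w'
  rw [← cancel_mono (eqToHom (F.obj_enl N).symm), Category.assoc, w']
  simp

/-- Preservation is given only for maximal inclusions. Composing with the monic from `K` to the
enlargement of `M` turns `m` into one, and the image of this monic is still monic, so it can be
cancelled afterwards. -/
theorem map_isPullback_inclusion (F : LocalFunctor C D) {P M K T : C} {q : P ⟶ M} {n : P ⟶ T}
    {m : M ⟶ K} {g : T ⟶ K} (hm : IsInclusion m) (h : IsPullback q n m g) :
    IsPullback (F.map q) (F.map n) (F.map m) (F.map g) := by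
  have h₁ := h.comp_mono (incl K ≫ eqToHom hm.enl_eq.symm)
  rw [hm.w] at h₁
  have h₂ := F.map_isPullback _ _ _ h₁
  have : Mono (F.map (incl K ≫ eqToHom hm.enl_eq.symm)) := by
    rw [F.map_comp, F.map_incl]
    infer_instance
  refine .of_comp_mono (F.map (incl K ≫ eqToHom hm.enl_eq.symm)) ?_
  rwa [← F.map_comp, ← F.map_comp, hm.w]

end LocalFunctor

namespace PartialMap

section

variable {C : Type u} [Category.{v} C] [LocalCategory C]
  {D : Type u} [Category.{v} D] [LocalCategory D]

/-- The image of an object that is its own enlargement. -/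
def mapEnlarged (F : LocalFunctor C D) (K : Enlarged C) : Enlarged D :=
  ⟨F.obj K.obj, (F.obj_enl K.obj).symm.trans (congrArg F.obj K.enl_obj)⟩

/-- The relation generated by the image of a partial map. -/
def mapRel (F : LocalFunctor C D) {K N : Enlarged C} (R : PartialMap K N) (T : D)
    (t : T ⟶ F.obj K.obj) (x : T ⟶ F.obj N.obj) : Prop :=
  ∃ (M : C) (m : M ⟶ K.obj) (f : M ⟶ N.obj) (u : T ⟶ F.obj M),
    R.rel M m f ∧ u ≫ F.map m = t ∧ u ≫ F.map f = x

/-- Every element of `R` factors through a representing span, so the image of that one span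
generates the relation. The definition of `mapRel` itself mentions no span, which keeps the action
on partial maps free of choices. -/
theorem Rep.mapRel_iff (F : LocalFunctor C D) {K N : Enlarged C} {R : PartialMap K N} {M : C}
    {m : M ⟶ K.obj} {f : M ⟶ N.obj} (h : R.Rep m f) {T : D} {t : T ⟶ F.obj K.obj}
    {x : T ⟶ F.obj N.obj} :
    mapRel F R T t x ↔ ∃ u : T ⟶ F.obj M, u ≫ F.map m = t ∧ u ≫ F.map f = x := by
  constructor
  · rintro ⟨M', m', f', u, hr, rfl, rfl⟩
    obtain ⟨v, rfl, rfl⟩ := (h.2 _ _ _).1 hr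
    exact ⟨u ≫ F.map v, by simp, by simp⟩
  · rintro ⟨u, rfl, rfl⟩
    exact ⟨M, m, f, u, h.rel, rfl, rfl⟩

/-- The image of a partial map under a local functor. -/
def map (F : LocalFunctor C D) {K N : Enlarged C} (R : PartialMap K N) :
    PartialMap (mapEnlarged F K) (mapEnlarged F N) where
  rel := mapRel F R
  exists_rep := by
    obtain ⟨M, m, f, hm, h⟩ := R.exists_rep
    exact ⟨F.obj M, F.map m, F.map f, F.map_isInclusion hm, fun T t x => Rep.mapRel_iff F ⟨hm, h⟩⟩

theorem Rep.map (F : LocalFunctor C D) {K N : Enlarged C} {R : PartialMap K N} {M : C}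
    {m : M ⟶ K.obj} {f : M ⟶ N.obj} (h : R.Rep m f) :
    (PartialMap.map F R).Rep (F.map m) (F.map f) :=
  ⟨F.map_isInclusion h.1, fun _ _ _ => h.mapRel_iff F⟩

theorem map_graph (F : LocalFunctor C D) {K N : Enlarged C} (f : K.obj ⟶ N.obj) :
    PartialMap.map F (graph f : PartialMap K N) =
      graph (K := mapEnlarged F K) (N := mapEnlarged F N) (F.map f) := by
  refine hom_ext (K := mapEnlarged F K) (N := mapEnlarged F N) fun T t x => ⟨?_, ?_⟩
  · rintro ⟨M, m, _, u, rfl, rfl, rfl⟩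
    exact (Category.assoc u (F.map m) (F.map f)).trans (by rw [← F.map_comp])
  · intro h
    exact ⟨K.obj, 𝟙 _, f, t, Category.id_comp f, by rw [F.map_id]; exact Category.comp_id _, h⟩

/-- The restriction functor on partial maps induced by a local functor. -/
def mapFunctor (F : LocalFunctor C D) : RestrictionFunctor (Enlarged C) (Enlarged D) where
  obj := mapEnlarged F
  map R := PartialMap.map F R
  map_id K := (map_graph F (𝟙 K.obj)).trans (congrArg graph (F.map_id K.obj))
  map_comp {K N P} R S := hom_ext fun T t x => by
    constructor
    · rintro ⟨M, m, f, u, ⟨y, hy, hx⟩, rfl, rfl⟩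
      exact ⟨u ≫ F.map y, ⟨M, m, y, u, hy, rfl, rfl⟩, M, y, f, u, hx, rfl, rfl⟩
    · obtain ⟨A, a, f, hR⟩ := PartialMap.exists_rep R
      obtain ⟨B, b, g, hS⟩ := PartialMap.exists_rep S
      obtain ⟨Q, q, n, hQ, hn⟩ := exists_pullback_inclusion hS.1 f
      -- Needed only for this half: an element of the composite of the images lifts to the image of
      -- the pullback `Q`, because `F` preserves it.
      have hF := F.map_isPullback_inclusion hS.1 hQ
      rintro ⟨y, hy, hx⟩
      obtain ⟨u, rfl, rfl⟩ := (Rep.mapRel_iff F hR).1 hy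
      obtain ⟨v, w, rfl⟩ := (Rep.mapRel_iff F hS).1 hx
      refine ⟨Q, n ≫ a, q ≫ g, hF.lift v u w, ⟨n ≫ f, R.rel_comp n (Rep.rel hR), ?_⟩, ?_, ?_⟩
      · rw [← hQ.w]
        exact S.rel_comp q (Rep.rel hS)
      · rw [F.map_comp, hF.lift_snd_assoc]
      · rw [F.map_comp, hF.lift_fst_assoc]
  map_rest {K N} R := hom_ext fun T t x => by
    constructor
    · rintro ⟨M, m, f, u, ⟨rfl, y, hy⟩, rfl, rfl⟩
      exact ⟨rfl, u ≫ F.map y, M, m, y, u, hy, rfl, rfl⟩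
    · rintro ⟨rfl, y, M, m, f, u, hy, rfl, rfl⟩
      exact ⟨M, m, m, u, ⟨rfl, f, hy⟩, rfl, rfl⟩

theorem isTotal_graph {K N : Enlarged C} (f : K.obj ⟶ N.obj) :
    RestrictionCategory.IsTotal (show K ⟶ N from graph f) :=
  hom_ext fun _ _ _ => rel_rest.trans ⟨fun h => rel_id.2 h.1, fun h => ⟨rel_id.1 h, _, rfl⟩⟩

/-- A natural transformation of local functors, as a restriction natural transformation. -/
def mapTransformation {F G : LocalFunctor C D} (θ : NatTrans F.toFunctor G.toFunctor) :
    RestrictionTransformation (mapFunctor F) (mapFunctor G) where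
  app K := (graph (θ.app K.obj) : PartialMap (mapEnlarged F K) (mapEnlarged G K))
  total K := isTotal_graph _
  naturality {K N} R := hom_ext fun T t x => by
    rw [(mapFunctor F).map_rest, rel_rest_comp]
    constructor
    · rintro ⟨y, ⟨M, m, f, u, h, rfl, rfl⟩, rfl⟩
      refine ⟨⟨_, M, m, f, u, h, rfl, rfl⟩, _, rfl, M, m, f, u ≫ θ.app M, h, ?_, ?_⟩
      · exact (Category.assoc _ _ _).trans ((congrArg (u ≫ ·) (θ.naturality m).symm).trans
          (Category.assoc _ _ _).symm)
      · exact (Category.assoc _ _ _).trans ((congrArg (u ≫ ·) (θ.naturality f).symm).trans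
          (Category.assoc _ _ _).symm)
    · obtain ⟨M, m, f, hR⟩ := PartialMap.exists_rep R
      rintro ⟨⟨z, hz⟩, y, rfl, hx⟩
      obtain ⟨u, rfl, rfl⟩ := (Rep.mapRel_iff F hR).1 hz
      obtain ⟨v, w, rfl⟩ := (Rep.mapRel_iff G hR).1 hx
      refine ⟨u ≫ F.map f, (Rep.mapRel_iff F hR).2 ⟨u, rfl, rfl⟩, ?_⟩
      -- The element `t` already lies in the domain of the image of `R` under `F`, through `u`.
      -- Since `G.map m` is monic, naturality at `m` leaves `u ≫ θ.app M` as the only possible `v`.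
      have := (G.map_isInclusion hR.1).mono
      have hv : v = u ≫ θ.app M := by
        rw [← cancel_mono (G.map m), w, Category.assoc, ← θ.naturality]
        exact Category.assoc _ _ _
      rw [hv]
      exact (Category.assoc _ _ _).trans ((congrArg (u ≫ ·) (θ.naturality f)).trans
        (Category.assoc _ _ _).symm)

end

variable {C : Type u} [Category.{u} C] [JoinLocalCategory C]
  {D : Type u} [Category.{u} D] [JoinLocalCategory D]

/-- The join restriction functor on partial maps induced by a local functor. -/
def mapJoin (F : JoinLocalFunctor C D) : JoinRestrictionFunctor (Enlarged C) (Enlarged D) where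
  toRestrictionFunctor := mapFunctor F.toLocalFunctor
  map_join {K N ι} R S hR hS := by
    choose M m f hM using fun i => PartialMap.exists_rep (R i)
    obtain ⟨A, a, s, hA⟩ := PartialMap.exists_rep S
    exact (isJoin_iff (fun i => Rep.map F.toLocalFunctor (hM i))
      (Rep.map F.toLocalFunctor hA)).2 (F.map_join f s (fun i => (hM i).1.enl_eq)
        (fun i j => (Rep.compatible_iff (hM i) (hM j)).1 (hR i j)) ((isJoin_iff hM hA).1 hS))

end PartialMap

/-! ### Strict equalities of 1-morphisms -/

namespace JRCat

theorem hom_ext {X Y : JRCat.{u}} {F G : X ⟶ Y} (h : F.toFunctor = G.toFunctor) : F = G := by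
  obtain ⟨⟨F, _⟩, _⟩ := F
  obtain ⟨⟨G, _⟩, _⟩ := G
  obtain rfl : F = G := h
  rfl

theorem eqToHom_conj_app {X Y : JRCat.{u}} {F F' G G' : X ⟶ Y} (h : F = F') (φ : F' ⟶ G')
    (h' : G' = G) (A : X.carrier) :
    RestrictionTransformation.app (eqToHom h ≫ φ ≫ eqToHom h') A =
      eqToHom (congrArg (fun H : X ⟶ Y => H.obj A) h) ≫ RestrictionTransformation.app φ A ≫
        eqToHom (congrArg (fun H : X ⟶ Y => H.obj A) h') := by
  subst h h'
  rfl

end JRCat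

namespace JLCat

theorem hom_ext {X Y : JLCat.{u}} {F G : X ⟶ Y} (h : F.toFunctor = G.toFunctor) : F = G := by
  obtain ⟨⟨F, _, _, _⟩, _⟩ := F
  obtain ⟨⟨G, _, _, _⟩, _⟩ := G
  obtain rfl : F = G := h
  rfl

end JLCat

/-- The join restriction category of partial maps of a join local category. -/
@[reducible]
def partialMapCat (C : JLCat.{u}) : JRCat.{u} := { carrier := Enlarged C.carrier }

/-- The 1-morphism of restriction categories of partial maps induced by a local functor. -/
def partialMapHom {C D : JLCat.{u}} (F : C ⟶ D) : partialMapCat C ⟶ partialMapCat D :=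
  PartialMap.mapJoin F

/-- The 2-morphism of restriction categories of partial maps induced by a natural
transformation. -/
def partialMapHom₂ {C D : JLCat.{u}} {F G : C ⟶ D} (θ : F ⟶ G) :
    partialMapHom F ⟶ partialMapHom G :=
  PartialMap.mapTransformation (F := F.toLocalFunctor) (G := G.toLocalFunctor) θ

/-- The relation generated by `R` under the identity is `R` again, since partial maps are closed
under precomposition of elements. With spans in place of relations this would not be an equality. -/
theorem partialMapHom_id (C : JLCat.{u}) : partialMapHom (𝟙 C) = 𝟙 (partialMapCat C) := by
  refine JRCat.hom_ext (CategoryTheory.Functor.ext (fun _ => rfl) fun K N R => ?_)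
  refine Eq.trans ?_ (((Category.id_comp _).trans (Category.comp_id R)).symm)
  refine PartialMap.hom_ext fun T t x => ⟨?_, fun h => ⟨T, t, x, 𝟙 T, h, ?_, ?_⟩⟩
  · rintro ⟨M, m, f, u, h, rfl, rfl⟩
    exact PartialMap.rel_comp R u h
  · exact Category.id_comp t
  · exact Category.id_comp x

theorem partialMapHom_comp {C D E : JLCat.{u}} (F : C ⟶ D) (G : D ⟶ E) :
    partialMapHom (F ≫ G) = partialMapHom F ≫ partialMapHom G := by
  refine JRCat.hom_ext (CategoryTheory.Functor.ext (fun _ => rfl) fun K N R => ?_)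
  refine Eq.trans ?_ (((Category.id_comp _).trans (Category.comp_id _)).symm)
  refine PartialMap.hom_ext fun T t x => ⟨?_, ?_⟩
  · rintro ⟨M, m, f, u, h, rfl, rfl⟩
    exact ⟨F.obj M, F.map m, F.map f, u, ⟨M, m, f, 𝟙 _, h, Category.id_comp _,
      Category.id_comp _⟩, rfl, rfl⟩
  · rintro ⟨_, _, _, u, ⟨M, m, f, w, h, rfl, rfl⟩, rfl, rfl⟩
    refine ⟨M, m, f, u ≫ G.map w, h, ?_, ?_⟩
    · exact (Category.assoc _ _ _).trans (congrArg (u ≫ ·) (G.map_comp _ _).symm)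
    · exact (Category.assoc _ _ _).trans (congrArg (u ≫ ·) (G.map_comp _ _).symm)

/-- The 2-functor that sends a join local category to its restriction category of partial maps. -/
def partialMapFunctor : StrictPseudofunctor JLCat.{u} JRCat.{u} :=
  StrictPseudofunctor.mk''
    { obj := partialMapCat
      map := partialMapHom
      map₂ := partialMapHom₂
      map₂_id := fun F => rfl
      map₂_comp := fun {C D F G H} φ ψ => RestrictionTransformation.ext <| funext fun K =>
        PartialMap.hom_ext fun T t x => by
          constructor
          · rintro rfl
            exact ⟨_, rfl, Category.assoc _ _ _⟩
          · rintro ⟨_, rfl, rfl⟩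
            exact (Category.assoc _ _ _).symm
      map_id := partialMapHom_id
      map_comp := partialMapHom_comp
      map₂_whisker_left := fun F G H φ => JRCat.hom₂_ext fun K => by
        rw [JRCat.eqToHom_conj_app]
        exact ((Category.id_comp _).trans (Category.comp_id _)).symm
      map₂_whisker_right := fun {X Y Z F G} φ H => JRCat.hom₂_ext fun K => by
        rw [JRCat.eqToHom_conj_app]
        refine Eq.trans ?_ ((Category.id_comp _).trans (Category.comp_id _)).symm
        exact (PartialMap.map_graph H.toLocalFunctor
          (K := PartialMap.mapEnlarged F.toLocalFunctor K)
          (N := PartialMap.mapEnlarged G.toLocalFunctor K) (NatTrans.app φ K.obj)).symm }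

/-! ### The unit -/

namespace RestrictionCategory

variable {X : Type u} [Category.{v} X] [RestrictionCategory X]
  {Y : Type u} [Category.{v} Y] [RestrictionCategory Y]

theorem le_map_iff (F : RestrictionFunctor X Y) [F.toFunctor.Faithful] {A B : X} {f g : A ⟶ B} :
    Le (F.map f) (F.map g) ↔ Le f g := by
  unfold Le
  rw [← F.map_rest, ← F.map_comp, F.map_injective.eq_iff]

theorem isJoin_map_iff (F : RestrictionFunctor X Y) [F.toFunctor.Full] [F.toFunctor.Faithful]
    {A B : X} {ι : Type v} {f : ι → (A ⟶ B)} {s : A ⟶ B} :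
    IsJoin (fun i => F.map (f i)) (F.map s) ↔ IsJoin f s := by
  constructor
  · exact fun h => ⟨fun i => (le_map_iff F).1 (h.le i),
      fun g hg => (le_map_iff F).1 (h.least _ fun i => (le_map_iff F).2 (hg i))⟩
  · refine fun h => ⟨fun i => (le_map_iff F).2 (h.le i), fun g hg => ?_⟩
    obtain ⟨g, rfl⟩ := F.map_surjective g
    exact (le_map_iff F).2 (h.least _ fun i => (le_map_iff F).1 (hg i))

theorem rest_eqToHom_comp {A A' B B' : X} (h : A = A') (h' : B' = B) (f : A' ⟶ B') :
    rest (eqToHom h ≫ f ≫ eqToHom h') = eqToHom h ≫ rest f ≫ eqToHom h.symm := by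
  subst h h'
  simp

theorem IsJoin.eqToHom_comp {A A' B B' : X} (h : A = A') (h' : B' = B) {ι : Type v}
    {f : ι → (A' ⟶ B')} {s : A' ⟶ B'} (hs : IsJoin f s) :
    IsJoin (fun i => eqToHom h ≫ f i ≫ eqToHom h') (eqToHom h ≫ s ≫ eqToHom h') := by
  subst h h'
  simpa using hs

end RestrictionCategory

/-- The inverse of a fully faithful functor that is surjective on objects, for a choice of
preimages of the objects. -/
noncomputable def CategoryTheory.Functor.sectionOfFullyFaithful {C D : Type u} [Category.{v} C]
    [Category.{v} D] (F : C ⥤ D) [F.Full] [F.Faithful] (g : D → C) (hg : ∀ p, F.obj (g p) = p) :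
    D ⥤ C where
  obj := g
  map {p q} f := F.preimage (eqToHom (hg p) ≫ f ≫ eqToHom (hg q).symm)
  map_id p := F.map_injective (by simp)
  map_comp f g := F.map_injective (by simp)

theorem CategoryTheory.Functor.map_sectionOfFullyFaithful {C D : Type u} [Category.{v} C]
    [Category.{v} D] (F : C ⥤ D) [F.Full] [F.Faithful] (g : D → C) (hg : ∀ p, F.obj (g p) = p)
    {p q : D} (f : p ⟶ q) : F.map ((F.sectionOfFullyFaithful g hg).map f) =
      eqToHom (hg p) ≫ f ≫ eqToHom (hg q).symm :=
  F.map_preimage _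

theorem CategoryTheory.Functor.comp_sectionOfFullyFaithful {C D : Type u} [Category.{v} C]
    [Category.{v} D] (F : C ⥤ D) [F.Full] [F.Faithful] (g : D → C) (hg : ∀ p, F.obj (g p) = p)
    (hg' : ∀ A, g (F.obj A) = A) : F ⋙ F.sectionOfFullyFaithful g hg = 𝟭 C :=
  CategoryTheory.Functor.ext hg' fun A B f => F.map_injective (by
    refine (F.map_sectionOfFullyFaithful g hg (F.map f)).trans ?_
    rw [F.map_comp, F.map_comp]
    exact congrArg₂ (· ≫ ·) (eqToHom_map F _).symm
      (congrArg₂ (· ≫ ·) rfl (eqToHom_map F _).symm))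

theorem CategoryTheory.Functor.sectionOfFullyFaithful_comp {C D : Type u} [Category.{v} C]
    [Category.{v} D] (F : C ⥤ D) [F.Full] [F.Faithful] (g : D → C) (hg : ∀ p, F.obj (g p) = p) :
    F.sectionOfFullyFaithful g hg ⋙ F = 𝟭 D :=
  CategoryTheory.Functor.ext hg fun _ _ f => F.map_sectionOfFullyFaithful g hg f

/-- The inverse of a fully faithful restriction functor that is surjective on objects. -/
noncomputable def JoinRestrictionFunctor.sectionOfFullyFaithful {X Y : Type u} [Category.{v} X]
    [RestrictionCategory X] [Category.{v} Y] [RestrictionCategory Y]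
    (F : JoinRestrictionFunctor X Y) [F.toFunctor.Full] [F.toFunctor.Faithful] (g : Y → X)
    (hg : ∀ p, F.obj (g p) = p) : JoinRestrictionFunctor Y X where
  toFunctor := F.toFunctor.sectionOfFullyFaithful g hg
  map_rest f := F.map_injective (by
    rw [F.map_rest, F.toFunctor.map_sectionOfFullyFaithful g hg,
      F.toFunctor.map_sectionOfFullyFaithful g hg]
    exact (RestrictionCategory.rest_eqToHom_comp _ _ _).symm)
  map_join f s _ h := by
    rw [← RestrictionCategory.isJoin_map_iff F.toRestrictionFunctor]
    simp only [F.toFunctor.map_sectionOfFullyFaithful g hg]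
    exact h.eqToHom_comp (hg _) (hg _).symm

theorem JRCat.isIsoOne_of_bijective {X Y : JRCat.{u}} (F : X ⟶ Y) [F.toFunctor.Full]
    [F.toFunctor.Faithful] (g : Y.carrier → X.carrier) (hg : ∀ p, F.obj (g p) = p)
    (hg' : ∀ A, g (F.obj A) = A) : IsIsoOne F :=
  ⟨JoinRestrictionFunctor.sectionOfFullyFaithful F g hg,
    hom_ext (F.toFunctor.comp_sectionOfFullyFaithful g hg hg'),
    hom_ext (F.toFunctor.sectionOfFullyFaithful_comp g hg)⟩

namespace PartialMap

variable {C : Type u} [Category.{v} C] [LocalCategory C]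

theorem rel_eqToHom_comp {K K' N : Enlarged C} (h : K = K') (R : K' ⟶ N) {T : C}
    {t : T ⟶ K.obj} {x : T ⟶ N.obj} :
    PartialMap.rel (eqToHom h ≫ R) T t x ↔
      PartialMap.rel R T (t ≫ eqToHom (congrArg Enlarged.obj h)) x := by
  subst h
  simp

theorem rel_comp_eqToHom {K N N' : Enlarged C} (h : N' = N) (R : K ⟶ N') {T : C}
    {t : T ⟶ K.obj} {x : T ⟶ N.obj} :
    PartialMap.rel (R ≫ eqToHom h) T t x ↔
      PartialMap.rel R T t (x ≫ eqToHom (congrArg Enlarged.obj h).symm) := by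
  subst h
  simp

end PartialMap

namespace Dom

open RestrictionCategory

section

variable {X : Type u} [Category.{u} X] [RestrictionCategory X]

/-- An object of a restriction category, as an object of the category of partial maps. -/
@[reducible]
def enlarged (A : X) : Enlarged (Dom X) := ⟨full A, rfl⟩

/-- The inclusion of the domain of definition of a morphism. -/
def domIncl {A B : X} (f : A ⟶ B) : (⟨A, rest f, rest_rest f⟩ : Dom X) ⟶ full A :=
  ⟨rest f, rest_rest f, Category.comp_id _⟩

/-- A morphism, as a total map on its domain of definition. -/
def domMap {A B : X} (f : A ⟶ B) : (⟨A, rest f, rest_rest f⟩ : Dom X) ⟶ full B :=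
  ⟨f, rfl, Category.comp_id _⟩

/-- If `t ≫ f` is still defined on all of `T`, then `t` has its values in the domain of `f`. -/
theorem comp_rest_eq_of_comp_eq {A B : X} {T : Dom X} {t : T.base ⟶ A} {f : A ⟶ B}
    (ht : rest t = T.idem) (h : rest (t ≫ f) = T.idem) : t ≫ rest f = t := by
  rw [comp_rest, h, ← ht, rest_comp]

theorem comp_eq_iff_exists {A B : X} (f : A ⟶ B) {T : Dom X} (t : T ⟶ full A) (x : T ⟶ full B) :
    t.val ≫ f = x.val ↔
      ∃ u : T ⟶ ⟨A, rest f, rest_rest f⟩, u ≫ domIncl f = t ∧ u ≫ domMap f = x := by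
  constructor
  · intro h
    have ht := comp_rest_eq_of_comp_eq t.rest_val ((congrArg rest h).trans x.rest_val)
    exact ⟨⟨t.val, t.rest_val, ht⟩, hom_ext ht, hom_ext h⟩
  · rintro ⟨u, rfl, rfl⟩
    exact (Category.assoc u.val (rest f) f).trans (congrArg (u.val ≫ ·) (rest_comp f))

/-- A morphism of a restriction category, as a partial map. -/
def toPartialMap {A B : X} (f : A ⟶ B) : PartialMap (enlarged A) (enlarged B) where
  rel _ t x := t.val ≫ f = x.val
  exists_rep := ⟨_, domIncl f, domMap f, (isInclusion_iff _).2 rfl,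
    fun _ t x => comp_eq_iff_exists f t x⟩

theorem rep_toPartialMap {A B : X} (f : A ⟶ B) :
    (toPartialMap f).Rep (domIncl f) (domMap f) :=
  ⟨(isInclusion_iff _).2 rfl, fun _ t x => comp_eq_iff_exists f t x⟩

variable (X) in
/-- The comparison of a restriction category with the category of partial maps of its local
category of restriction idempotents. -/
def unitFunctor : RestrictionFunctor X (Enlarged (Dom X)) where
  obj := enlarged
  map f := toPartialMap f
  map_id A := PartialMap.hom_ext fun T t x => Iff.trans (by
    change t.val ≫ 𝟙 A = x.val ↔ _
    rw [Category.comp_id]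
    exact ⟨fun h => hom_ext h, fun h => congrArg Hom.val h⟩) PartialMap.rel_id.symm
  map_comp {A B D} f g := PartialMap.hom_ext fun T t x => by
    constructor
    · intro h
      have h : t.val ≫ f ≫ g = x.val := h
      refine ⟨⟨t.val ≫ f, ?_, Category.comp_id _⟩, rfl, (Category.assoc _ _ _).trans h⟩
      -- The intermediate value `t.val ≫ f` is total on `T`: its domain lies between those of `t.val
      -- ≫ f ≫ g` and of `t.val`, both equal to `T.idem`.
      have h₁ := rest_comp_rest_left (t.val ≫ f) g
      have h₂ := rest_comp_rest_left t.val f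
      rw [Category.assoc, h, x.rest_val] at h₁
      rw [t.rest_val] at h₂
      rw [← h₂, ← t.rest_val, rest_comm, t.rest_val, h₁]
    · rintro ⟨y, hy, hx⟩
      have hy : t.val ≫ f = y.val := hy
      have hx : y.val ≫ g = x.val := hx
      rw [← hy, Category.assoc] at hx
      exact hx
  map_rest {A B} f := PartialMap.hom_ext fun T t x => by
    constructor
    · intro h
      have h : t.val ≫ rest f = x.val := h
      have h₁ : rest (t.val ≫ f) = T.idem := by rw [← rest_comp_rest, h, x.rest_val]
      refine ⟨hom_ext ?_, ⟨t.val ≫ f, h₁, Category.comp_id _⟩, rfl⟩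
      rw [← h, comp_rest_eq_of_comp_eq t.rest_val h₁]
    · rintro ⟨rfl, y, hy⟩
      have hy : t.val ≫ f = y.val := hy
      exact comp_rest_eq_of_comp_eq t.rest_val ((congrArg rest hy).trans y.rest_val)

/-- Evaluating the relation of `g` at the generic element `(rest f, f)` of `f` says exactly `rest f
≫ g = f`, so equal relations give `f ≤ g` and `g ≤ f`. -/
instance : (unitFunctor X).Faithful where
  map_injective {A B f g} h := by
    have key : ∀ {f g : A ⟶ B}, toPartialMap f = toPartialMap g → Le f g := fun {f g} h => by
      have h₁ := (rep_toPartialMap f).rel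
      rw [h] at h₁
      exact h₁
    exact (key h).antisymm (key h.symm)

/-- A span representing a partial map consists of an idempotent `e` on `A` and a map out of `(A,
e)`, that is, an `f : A ⟶ B` with `rest f = e`; this `f` is the preimage. -/
instance : (unitFunctor X).Full where
  map_surjective {A B} R := by
    obtain ⟨M, m, f, hm, h⟩ := PartialMap.exists_rep R
    obtain ⟨e, he, rfl⟩ := exists_idem (K := full A) hm.enl_eq
    have hm' := (isInclusion_iff m).1 hm
    obtain ⟨f, hf, hf'⟩ := f
    change A ⟶ B at f
    obtain rfl : rest f = e := hf
    refine ⟨f, PartialMap.hom_ext fun T t x => Iff.trans ?_ (h T t x).symm⟩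
    obtain rfl : m = domIncl f := hom_ext hm'
    exact (rep_toPartialMap f).2 T t x

end

end Dom

/-- The local category of restriction idempotents of a join restriction category. -/
@[reducible]
def domCat (X : JRCat.{u}) : JLCat.{u} := { carrier := Dom X.carrier }

/-- The unit at a join restriction category. -/
def unitHom (X : JRCat.{u}) : X ⟶ partialMapCat (domCat X) :=
  { toRestrictionFunctor := Dom.unitFunctor X.carrier
    map_join := fun _ _ _ h => (RestrictionCategory.isJoin_map_iff _).2 h }

instance (X : JRCat.{u}) : (unitHom X).toFunctor.Full :=
  inferInstanceAs (Dom.unitFunctor X.carrier).Full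

instance (X : JRCat.{u}) : (unitHom X).toFunctor.Faithful :=
  inferInstanceAs (Dom.unitFunctor X.carrier).Faithful

/-- An object of `Dom X` that equals its enlargement is the identity idempotent on its base, so
taking the base inverts the unit on objects. -/
theorem isIsoOne_unitHom (X : JRCat.{u}) : IsIsoOne (unitHom X) :=
  JRCat.isIsoOne_of_bijective (unitHom X) (fun p => p.obj.base)
    (fun p => Enlarged.ext p.enl_obj) (fun _ => rfl)

/-! ### Naturality of the unit. -/

namespace Dom

open RestrictionCategory

variable {X : Type u} [Category.{u} X] [JoinRestrictionCategory X]
  {Y : Type u} [Category.{u} Y] [JoinRestrictionCategory Y]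

theorem enlarged_map (F : JoinRestrictionFunctor X Y) (A : X) :
    enlarged (F.obj A) = PartialMap.mapEnlarged (mapLocal F).toLocalFunctor (enlarged A) :=
  Enlarged.ext (mapFunctor_full F.toRestrictionFunctor A).symm

theorem comp_eqToHom_enlarged_val (F : JoinRestrictionFunctor X Y) {A : X} {T : Dom Y}
    (t : T ⟶ full (F.obj A)) :
    (t ≫ eqToHom (congrArg Enlarged.obj (enlarged_map F A))).val = t.val :=
  (comp_eqToHom_val t (congrArg Enlarged.obj (enlarged_map F A)) rfl).trans (Category.comp_id _)

theorem comp_eqToHom_enlarged_val_symm (F : JoinRestrictionFunctor X Y) {A : X} {T : Dom Y}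
    (t : T ⟶ (mapLocal F).obj (full A)) :
    (t ≫ eqToHom (congrArg Enlarged.obj (enlarged_map F A)).symm).val = t.val :=
  (comp_eqToHom_val t (congrArg Enlarged.obj (enlarged_map F A)).symm rfl).trans
    (Category.comp_id _)

theorem comp_mapTransformation_iff {F G : JoinRestrictionFunctor X Y}
    (φ : RestrictionTransformation F.toRestrictionFunctor G.toRestrictionFunctor) {A : X}
    {T : Dom Y} (t : T ⟶ full (F.obj A)) (x : T ⟶ (mapLocal G).obj (full A)) :
    t.val ≫ φ.app A = (x ≫ eqToHom (congrArg Enlarged.obj (enlarged_map G A)).symm).val ↔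
      (t ≫ eqToHom (congrArg Enlarged.obj (enlarged_map F A))) ≫
        (mapTransformation φ).app (full A) = x := by
  rw [comp_eqToHom_enlarged_val_symm]
  have e : (t ≫ eqToHom (congrArg Enlarged.obj (enlarged_map F A))).val ≫
      F.map (𝟙 A) ≫ φ.app A = t.val ≫ φ.app A := by
    rw [comp_eqToHom_enlarged_val, F.map_id]
    exact congrArg (t.val ≫ ·) (Category.id_comp _)
  exact ⟨fun h => hom_ext (e.trans h), fun h => e.symm.trans (congrArg Hom.val h)⟩

/-- The transports do not change underlying maps, so on elements both sides say `t.val ≫ F.map f =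
x.val`. For the right side, `t` must also factor through the idempotent `F.map (rest f)`, which
totality of `x` on `T` ensures. -/
theorem toPartialMap_map (F : JoinRestrictionFunctor X Y) {A B : X} (f : A ⟶ B) :
    (toPartialMap (F.map f) : enlarged (F.obj A) ⟶ enlarged (F.obj B)) =
      eqToHom (enlarged_map F A) ≫
        (show PartialMap.mapEnlarged (mapLocal F).toLocalFunctor (enlarged A) ⟶
          PartialMap.mapEnlarged (mapLocal F).toLocalFunctor (enlarged B) from
          PartialMap.map (mapLocal F).toLocalFunctor (toPartialMap f)) ≫
        eqToHom (enlarged_map F B).symm := by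
  refine PartialMap.hom_ext fun T t x => ?_
  rw [PartialMap.rel_eqToHom_comp, PartialMap.rel_comp_eqToHom]
  refine Iff.trans ?_
    (PartialMap.Rep.mapRel_iff (mapLocal F).toLocalFunctor (rep_toPartialMap f)).symm
  have et := comp_eqToHom_enlarged_val F t
  have ex := comp_eqToHom_enlarged_val F x
  constructor
  · intro h
    have h : t.val ≫ F.map f = x.val := h
    have h₁ : t.val ≫ F.map (rest f) = t.val := by
      rw [F.map_rest]
      exact comp_rest_eq_of_comp_eq t.rest_val ((congrArg rest h).trans x.rest_val)
    exact ⟨⟨t.val, t.rest_val, h₁⟩, hom_ext (h₁.trans et.symm), hom_ext (h.trans ex.symm)⟩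
  · rintro ⟨w, hw, hw'⟩
    have h₁ : w.val ≫ F.map (rest f) = t.val := (congrArg Hom.val hw).trans et
    have h₂ : w.val ≫ F.map f = x.val := (congrArg Hom.val hw').trans ex
    have h₃ : w.val ≫ F.map (rest f) = w.val := w.val_idem
    exact (congrArg (· ≫ F.map f) (h₁.symm.trans h₃)).trans h₂

end Dom

theorem unitHom_naturality {X Y : JRCat.{u}} (F : X ⟶ Y) :
    F ≫ unitHom Y = unitHom X ≫ partialMapHom (domFunctor.map F) :=
  JRCat.hom_ext (CategoryTheory.Functor.ext (fun A => Dom.enlarged_map F A)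
    fun _ _ f => Dom.toPartialMap_map F f)

theorem JRCat.eqToHom_comp_app {X Y : JRCat.{u}} {F F' G : X ⟶ Y} (h : F = F') (φ : F' ⟶ G)
    (A : X.carrier) : RestrictionTransformation.app (eqToHom h ≫ φ) A =
      eqToHom (congrArg (fun H : X ⟶ Y => H.obj A) h) ≫ RestrictionTransformation.app φ A := by
  subst h
  exact congrArg (RestrictionTransformation.app · A) (Category.id_comp φ) |>.trans
    (Category.id_comp _).symm

theorem JRCat.comp_eqToHom_app {X Y : JRCat.{u}} {F G' G : X ⟶ Y} (φ : F ⟶ G') (h : G' = G)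
    (A : X.carrier) : RestrictionTransformation.app (φ ≫ eqToHom h) A =
      RestrictionTransformation.app φ A ≫ eqToHom (congrArg (fun H : X ⟶ Y => H.obj A) h) := by
  subst h
  rfl

/-- The unit of the 2-equivalence. -/
def unitTransformation :
    TwoNatTrans (StrictPseudofunctor.id JRCat.{u}) (domFunctor.comp partialMapFunctor) where
  app := unitHom
  naturality F := unitHom_naturality F
  naturality₂ {X Y F G} θ := JRCat.hom₂_ext fun A => by
    refine (JRCat.comp_eqToHom_app (X := X) (Y := partialMapCat (domCat Y)) _ _ A).trans
      (Eq.trans ?_ (JRCat.eqToHom_comp_app (X := X) (Y := partialMapCat (domCat Y)) _ _ A).symm)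
    refine PartialMap.hom_ext fun T t x => ?_
    refine (PartialMap.rel_comp_eqToHom _ _).trans
      (Iff.trans ?_ (PartialMap.rel_eqToHom_comp _ _).symm)
    exact Dom.comp_mapTransformation_iff θ t x

/-! ### Equivalences of local categories -/

/-- The unit of the equivalence given by a fully faithful functor that is surjective on
objects. -/
noncomputable def CategoryTheory.Functor.compSectionIso {C D : Type u} [Category.{v} C]
    [Category.{v} D] (F : C ⥤ D) [F.Full] [F.Faithful] (g : D → C)
    (hg : ∀ p, F.obj (g p) = p) : 𝟭 C ≅ F ⋙ F.sectionOfFullyFaithful g hg :=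
  NatIso.ofComponents (fun M => F.preimageIso (eqToIso (hg (F.obj M)).symm)) fun {M N} f =>
    F.map_injective (by
      rw [F.map_comp, F.map_comp]
      refine Eq.trans ?_ (congrArg₂ (· ≫ ·) (F.map_preimage _).symm
        (F.map_sectionOfFullyFaithful g hg (F.map f)).symm)
      refine (congrArg₂ (· ≫ ·) rfl (F.map_preimage _)).trans ?_
      have key : F.map f ≫ eqToHom (hg (F.obj N)).symm = eqToHom (hg (F.obj M)).symm ≫
          eqToHom (hg (F.obj M)) ≫ F.map f ≫ eqToHom (hg (F.obj N)).symm := by simp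
      exact key)

theorem CategoryTheory.Functor.isEquivalence_section {C D : Type u} [Category.{v} C]
    [Category.{v} D] (F : C ⥤ D) [F.Full] [F.Faithful] (g : D → C)
    (hg : ∀ p, F.obj (g p) = p) : (F.sectionOfFullyFaithful g hg).IsEquivalence :=
  (CategoryTheory.Equivalence.mk _ F
    (eqToIso (F.sectionOfFullyFaithful_comp g hg).symm)
    (F.compSectionIso g hg).symm).isEquivalence_functor


namespace LocalFunctor

variable {C : Type u} [Category.{v} C] [LocalCategory C]
  {D : Type u} [Category.{v} D] [LocalCategory D]

/-- An equivalence of categories that preserves maximal inclusions is a local functor. -/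
def ofIsEquivalence (F : C ⥤ D) [F.IsEquivalence]
    (obj_enl : ∀ M, F.obj (enl M) = enl (F.obj M))
    (map_incl : ∀ M, F.map (incl M) = incl (F.obj M) ≫ eqToHom (obj_enl M).symm) :
    LocalFunctor C D where
  toFunctor := F
  obj_enl := obj_enl
  map_incl := map_incl
  map_isPullback _ _ _ h := h.map F

/-- Being an inclusion contains an equality of enlargements, which faithfulness cannot reflect; `hF`
provides it. -/
theorem isInclusion_of_map (F : LocalFunctor C D) [F.toFunctor.Faithful]
    (hF : ∀ M N : C, F.obj (enl M) = F.obj (enl N) → enl M = enl N) {M N : C} {m : M ⟶ N}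
    (hm : IsInclusion (F.map m)) : IsInclusion m := by
  obtain ⟨h, w⟩ := hm
  refine ⟨hF _ _ ((F.obj_enl M).trans (h.trans (F.obj_enl N).symm)), F.map_injective ?_⟩
  rw [F.map_comp, F.map_comp, F.map_incl, F.map_incl, eqToHom_map, ← Category.assoc, w]
  simp

theorem map_le_iff (F : LocalFunctor C D) [F.toFunctor.Full] [F.toFunctor.Faithful]
    (hF : ∀ M N : C, F.obj (enl M) = F.obj (enl N) → enl M = enl N) {A B N : C} {f : A ⟶ N}
    {g : B ⟶ N} : Le (F.map f) (F.map g) ↔ Le f g := by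
  constructor
  · rintro ⟨m, hm, w⟩
    obtain ⟨m, rfl⟩ := F.map_surjective m
    exact ⟨m, F.isInclusion_of_map hF hm, F.map_injective (by rw [F.map_comp, w])⟩
  · rintro ⟨m, hm, rfl⟩
    exact ⟨F.map m, F.map_isInclusion hm, (F.map_comp _ _).symm⟩

/-- A competing upper bound may have a domain outside the image of `F`. By `hs` that domain can be
replaced by some `F.obj A` along an invertible inclusion, after which fullness moves the comparison
to `C`. -/
theorem map_isJoin (F : LocalFunctor C D) [F.toFunctor.Full] [F.toFunctor.Faithful]
    (hF : ∀ M N : C, F.obj (enl M) = F.obj (enl N) → enl M = enl N)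
    (hs : ∀ p : D, ∃ (M : C) (i : F.obj M ⟶ p), IsIso i ∧ IsInclusion i)
    {K N : C} {ι : Type (max u v)} {M : ι → C} {f : ∀ i, M i ⟶ N} {S : C} {s : S ⟶ N}
    (h : IsJoin K f s) : IsJoin (F.obj K) (fun i => F.map (f i)) (F.map s) where
  enl_eq := by rw [← F.obj_enl, ← F.obj_enl, h.enl_eq]
  le i := (F.map_le_iff hF).2 (h.le i)
  least {T} g hT H := by
    obtain ⟨A, i, _, hi⟩ := hs T
    obtain ⟨g', hg'⟩ := F.map_surjective (i ≫ g)
    obtain ⟨m, hm, w⟩ := (F.map_le_iff hF).2 (h.least g'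
      (hF _ _ (by rw [F.obj_enl, F.obj_enl, hi.enl_eq, hT])) fun j => by
        obtain ⟨m, hm, w⟩ := H j
        refine (F.map_le_iff hF).1 ⟨m ≫ inv i, hm.comp hi.inv, ?_⟩
        rw [hg', Category.assoc, IsIso.inv_hom_id_assoc, w])
    exact ⟨m ≫ i, hm.comp hi, by rw [Category.assoc, ← hg', w]⟩

end LocalFunctor

theorem LocalCategory.incl_eq_of_eq {C : Type u} [Category.{v} C] [LocalCategory C] {M N : C}
    (h : M = N) : incl M = eqToHom h ≫ incl N ≫ eqToHom (congrArg enl h).symm := by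
  subst h
  simp

namespace LocalFunctor

variable {C : Type u} [Category.{v} C] [LocalCategory C]
  {D : Type u} [Category.{v} D] [LocalCategory D]

/-- A choice of preimages of objects that is compatible with enlargements. -/
theorem exists_section (F : LocalFunctor C D)
    (hF : ∀ M N : C, F.obj (enl M) = F.obj (enl N) → enl M = enl N)
    (hs : ∀ p : D, ∃ M : C, F.obj M = p) :
    ∃ g : D → C, (∀ p, F.obj (g p) = p) ∧ ∀ p, g (enl p) = enl (g p) := by
  classical
  -- Above the image of an enlargement the preimage is chosen to be an enlargement; by `hF` there is
  -- only one. As `enl p` is the image of `enl (g p)`, the choice commutes with `enl`.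
  let g : D → C := fun p =>
    if h : ∃ M, F.obj (enl M) = p then enl h.choose else (hs p).choose
  have hg : ∀ p, F.obj (g p) = p := fun p => by
    by_cases h : ∃ M, F.obj (enl M) = p
    · simp only [g, dif_pos h]
      exact h.choose_spec
    · simp only [g, dif_neg h]
      exact (hs p).choose_spec
  have hg' : ∀ M, g (F.obj (enl M)) = enl M := fun M => by
    have h : ∃ M', F.obj (enl M') = F.obj (enl M) := ⟨M, rfl⟩
    simp only [g, dif_pos h]
    exact hF _ _ h.choose_spec
  refine ⟨g, hg, fun p => ?_⟩
  rw [← hg' (g p), F.obj_enl, hg]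

variable (F : LocalFunctor C D) [F.toFunctor.Full] [F.toFunctor.Faithful]
  (g : D → C) (hg : ∀ p, F.obj (g p) = p) (hg' : ∀ p, g (enl p) = enl (g p))

/-- The inverse of a fully faithful local functor that is surjective on objects. -/
noncomputable def sectionOfFullyFaithful : LocalFunctor D C :=
  have := F.toFunctor.isEquivalence_section g hg
  ofIsEquivalence (F.toFunctor.sectionOfFullyFaithful g hg) hg' fun p => F.map_injective (by
    rw [F.toFunctor.map_sectionOfFullyFaithful g hg, F.map_comp, F.map_incl, eqToHom_map]
    refine Eq.trans ?_ (congrArg (fun k => (k ≫ eqToHom (F.obj_enl (g p)).symm) ≫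
      eqToHom (congrArg F.obj (hg' p).symm)) (incl_eq_of_eq (hg p)).symm)
    have key : eqToHom (hg p) ≫ incl p ≫ eqToHom (hg (enl p)).symm =
        ((eqToHom (hg p) ≫ incl p ≫ eqToHom (congrArg enl (hg p)).symm) ≫
          eqToHom (F.obj_enl (g p)).symm) ≫ eqToHom (congrArg F.obj (hg' p).symm) := by simp
    exact key)

instance : (F.sectionOfFullyFaithful g hg hg').toFunctor.IsEquivalence :=
  F.toFunctor.isEquivalence_section g hg

theorem exists_inclusion_section (F : LocalFunctor C D) [F.toFunctor.Full] [F.toFunctor.Faithful]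
    (g : D → C) (hg : ∀ p, F.obj (g p) = p)
    (hF : ∀ M N : C, F.obj (enl M) = F.obj (enl N) → enl M = enl N) (M : C) :
    ∃ i : g (F.obj M) ⟶ M, IsIso i ∧ IsInclusion i :=
  ⟨F.toFunctor.preimage (eqToHom (hg (F.obj M))),
    (F.toFunctor.preimageIso (eqToIso (hg (F.obj M)))).isIso_hom,
    F.isInclusion_of_map hF (by
      rw [F.map_preimage]
      exact .eqToHom _)⟩

end LocalFunctor

/-- The section `G` satisfies `G ≫ F = 𝟙 D` strictly, while `F ≫ G` is only naturally isomorphic to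
`𝟙 C`. This suffices since all natural transformations are 2-morphisms. -/
theorem JLCat.isEquivalenceOne_of_surjective {C D : JLCat.{u}} (F : C ⟶ D) [F.toFunctor.Full]
    [F.toFunctor.Faithful]
    (hF : ∀ M N : C.carrier, F.obj (enl M) = F.obj (enl N) → enl M = enl N)
    (hs : ∀ p : D.carrier, ∃ M : C.carrier, F.obj M = p) : IsEquivalenceOne F := by
  obtain ⟨g, hg, hg'⟩ := F.toLocalFunctor.exists_section hF hs
  let G : D ⟶ C :=
    { toLocalFunctor := F.toLocalFunctor.sectionOfFullyFaithful g hg hg'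
      -- `G` separates enlargements because `F` undoes it, and each `M` is reached from `g (F.obj
      -- M)` by an invertible inclusion.
      map_join := fun {K N ι M} f S s _ _ h => LocalFunctor.map_isJoin _ (fun p q h => by
          have h' : F.obj (g (enl p)) = F.obj (g (enl q)) := congrArg F.obj h
          rwa [hg, hg] at h')
        (fun M => ⟨_, F.toLocalFunctor.exists_inclusion_section g hg hF M⟩) h }
  let α := F.toFunctor.compSectionIso g hg
  let η : 𝟙 C ≅ F ≫ G :=
    { hom := α.hom
      inv := α.inv
      hom_inv_id := α.hom_inv_id
      inv_hom_id := α.inv_hom_id }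
  exact ⟨Bicategory.Equivalence.mkOfAdjointifyCounit η
    (eqToIso (JLCat.hom_ext (F.toFunctor.sectionOfFullyFaithful_comp g hg))), rfl⟩

/-! ### The counit -/

namespace PartialMap

open RestrictionCategory

section

variable {C : Type u} [Category.{u} C] [LocalCategory C]

/-- The enlargement of an object. -/
@[reducible]
def enlargement (M : C) : Enlarged C := ⟨enl M, enl_enl M⟩

/-- A morphism, as a partial map between the enlargements. -/
def ofHom {M N : C} (f : M ⟶ N) : PartialMap (enlargement M) (enlargement N) :=
  ofRep (incl M) (f ≫ incl N) (isInclusion_incl M)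

theorem rel_ofHom {M N : C} {f : M ⟶ N} {T : C} {t : T ⟶ enl M} {x : T ⟶ enl N} :
    (ofHom f).rel T t x ↔ ∃ u : T ⟶ M, u ≫ incl M = t ∧ u ≫ f ≫ incl N = x := Iff.rfl

theorem rel_ofHom_id {M : C} {T : C} {t x : T ⟶ enl M} :
    (ofHom (𝟙 M)).rel T t x ↔ t = x ∧ ∃ u : T ⟶ M, u ≫ incl M = t := by
  rw [rel_ofHom]
  constructor
  · rintro ⟨u, rfl, rfl⟩
    exact ⟨by simp, u, rfl⟩
  · rintro ⟨rfl, u, rfl⟩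
    exact ⟨u, rfl, by simp⟩

theorem ofHom_comp {M N P : C} (f : M ⟶ N) (g : N ⟶ P) :
    (ofHom (f ≫ g) : enlargement M ⟶ enlargement P) =
      (show enlargement M ⟶ enlargement N from ofHom f) ≫
        (show enlargement N ⟶ enlargement P from ofHom g) := by
  refine hom_ext fun T t x => ⟨?_, ?_⟩
  · rintro ⟨u, rfl, rfl⟩
    exact ⟨u ≫ f ≫ incl N, ⟨u, rfl, rfl⟩, u ≫ f, by simp, by simp⟩
  · rintro ⟨y, ⟨u, rfl, rfl⟩, v, hv, rfl⟩
    rw [← Category.assoc, cancel_mono] at hv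
    exact ⟨u, rfl, by rw [hv]; simp⟩

theorem rest_ofHom {M N : C} (f : M ⟶ N) :
    rest (show enlargement M ⟶ enlargement N from ofHom f) = ofHom (𝟙 M) := by
  refine hom_ext fun T t x => Iff.trans ?_ rel_ofHom_id.symm
  constructor
  · rintro ⟨rfl, y, u, rfl, rfl⟩
    exact ⟨rfl, u, rfl⟩
  · rintro ⟨rfl, u, rfl⟩
    exact ⟨rfl, u ≫ f ≫ incl N, u, rfl, rfl⟩

variable (C) in
/-- The comparison of a local category with the local category of restriction idempotents of its
partial maps. -/
def counitFunctor : C ⥤ Dom (Enlarged C) where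
  obj M := ⟨enlargement M, ofHom (𝟙 M), rest_ofHom _⟩
  map {_ N} f := ⟨ofHom f, rest_ofHom f,
    (ofHom_comp f (𝟙 N)).symm.trans (congrArg ofHom (Category.comp_id f))⟩
  map_id _ := rfl
  map_comp f g := Dom.hom_ext (ofHom_comp f g)

/-- Replaces a heterogeneous equality of idempotents by a description of the relation of `p.idem` on
elements. -/
theorem counitFunctor_obj_eq {M : C} {p : Dom (Enlarged C)} (h : enl M = p.base.obj)
    (hp : ∀ T t x, PartialMap.rel p.idem T t x ↔
      ∃ u : T ⟶ M, u ≫ incl M ≫ eqToHom h = t ∧ u ≫ incl M ≫ eqToHom h = x) :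
    (counitFunctor C).obj M = p := by
  obtain ⟨⟨K, hK⟩, e, he⟩ := p
  change enl M = K at h
  subst h
  refine Dom.ext rfl (heq_of_eq (hom_ext fun T t x => Iff.trans ?_ (hp T t x).symm))
  refine rel_ofHom.trans ?_
  simp

theorem counitFunctor_obj_enl (M : C) :
    (counitFunctor C).obj (enl M) = enl ((counitFunctor C).obj M) :=
  counitFunctor_obj_eq (enl_enl M) fun T t x => by
    have key : incl (enl M) ≫ eqToHom (enl_enl M) = 𝟙 (enl M) := by rw [incl_enl]; simp
    refine (PartialMap.rel_id (K := enlargement M)).trans ?_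
    constructor
    · rintro rfl
      exact ⟨t, (congrArg (t ≫ ·) key).trans (Category.comp_id t),
        (congrArg (t ≫ ·) key).trans (Category.comp_id t)⟩
    · rintro ⟨u, rfl, rfl⟩
      rfl

/-- Only the enlargement can be recovered: objects with inclusions in both directions have the same
image. -/
theorem counitFunctor_obj_injective {M N : C}
    (h : (counitFunctor C).obj M = (counitFunctor C).obj N) : enl M = enl N :=
  congrArg (fun p : Dom (Enlarged C) => p.base.obj) h

/-- A restriction idempotent relates only equal elements, so both legs of a span representing it
coincide. The common leg is an inclusion into an enlarged object, hence the maximal inclusion of its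
source up to transport. -/
theorem counitFunctor_obj_surjective (p : Dom (Enlarged C)) :
    ∃ M, (counitFunctor C).obj M = p := by
  obtain ⟨K, e, he⟩ := p
  obtain ⟨M, m, f, hm, h⟩ := PartialMap.exists_rep e
  have hM : enl M = K.obj := hm.enl_eq.trans K.enl_obj
  have hm' : incl M ≫ eqToHom hM = m := ((isInclusion_incl M).comp (.eqToHom _)).unique hm
  have hf : f = m := by
    have h₁ : PartialMap.rel e M m f := (h _ _ _).2 ⟨𝟙 M, by simp⟩
    rw [← he] at h₁
    exact h₁.1.symm
  refine ⟨M, counitFunctor_obj_eq hM fun T t x => (h T t x).trans ?_⟩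
  rw [hf, hm']

instance : (counitFunctor C).Faithful where
  map_injective {M N f g} h := by
    have h₁ : (ofHom f).rel M (incl M) (f ≫ incl N) := ⟨𝟙 M, by simp⟩
    rw [show ofHom f = ofHom g from congrArg Dom.Hom.val h] at h₁
    obtain ⟨u, hu, hu'⟩ := h₁
    have hu'' : u = 𝟙 M := by rw [← cancel_mono (incl M), hu, Category.id_comp]
    rw [hu'', Category.id_comp, cancel_mono] at hu'
    exact hu'.symm

/-- Evaluate `R` at the generic element `incl M`. Since the domain of `R` is `M`, there is a value
`y : M ⟶ enl N`; since `R` has values in `N`, it factors as `u ≫ incl N`, and `u` is the preimage.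
-/
instance : (counitFunctor C).Full where
  map_surjective {M N} R := by
    have hR : rest R.val = ofHom (𝟙 M) := R.rest_val
    have hR' : R.val ≫ (show enlargement N ⟶ enlargement N from ofHom (𝟙 N)) = R.val := R.val_idem
    have h₁ : (ofHom (𝟙 M)).rel M (incl M) (incl M) := ⟨𝟙 M, by simp⟩
    rw [← hR] at h₁
    obtain ⟨-, y, hy⟩ := h₁
    have hy' := hy
    rw [← hR'] at hy'
    obtain ⟨z, -, hz⟩ := hy'
    obtain ⟨rfl, u, hu⟩ := rel_ofHom_id.1 hz
    refine ⟨u, Dom.hom_ext (hom_ext fun T t x => ⟨?_, fun h => ?_⟩)⟩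
    · rintro ⟨v, rfl, rfl⟩
      rw [hu]
      exact PartialMap.rel_comp _ v hy
    · have h₂ : PartialMap.rel (rest R.val) T t t := ⟨rfl, x, h⟩
      rw [hR] at h₂
      obtain ⟨-, v, rfl⟩ := rel_ofHom_id.1 h₂
      refine ⟨v, rfl, ?_⟩
      rw [hu]
      exact PartialMap.functional _ (PartialMap.rel_comp _ v hy) h

instance : (counitFunctor C).IsEquivalence where
  essSurj := ⟨fun p => by
    obtain ⟨M, hM⟩ := counitFunctor_obj_surjective p
    exact ⟨M, ⟨eqToIso hM⟩⟩⟩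

theorem counitFunctor_map_incl (M : C) :
    (counitFunctor C).map (incl M) = incl ((counitFunctor C).obj M) ≫
      eqToHom (counitFunctor_obj_enl M).symm := by
  have hb : enlargement M = enlargement (enl M) := Enlarged.ext (enl_enl M).symm
  refine Dom.hom_ext (Eq.trans ?_ (Dom.comp_eqToHom_val
    (incl ((counitFunctor C).obj M)) (counitFunctor_obj_enl M).symm hb).symm)
  refine hom_ext fun T t x => Iff.trans ?_ (PartialMap.rel_comp_eqToHom hb _).symm
  refine Iff.trans ?_ (rel_ofHom (f := 𝟙 M)).symm
  refine exists_congr fun u => and_congr Iff.rfl ?_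
  rw [incl_enl, Category.id_comp, ← Category.assoc]
  exact comp_eqToHom_iff (enl_enl M).symm _ _

variable (C) in
/-- The comparison of a local category with the local category of restriction idempotents of its
partial maps, as a local functor. -/
def counitLocalFunctor : LocalFunctor C (Dom (Enlarged C)) :=
  .ofIsEquivalence (counitFunctor C) counitFunctor_obj_enl counitFunctor_map_incl

instance : (counitLocalFunctor C).toFunctor.Full := inferInstanceAs (counitFunctor C).Full

instance : (counitLocalFunctor C).toFunctor.Faithful := inferInstanceAs (counitFunctor C).Faithful

theorem counitLocalFunctor_obj_enl_injective {M N : C}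
    (h : (counitLocalFunctor C).obj (enl M) = (counitLocalFunctor C).obj (enl N)) :
    enl M = enl N :=
  (enl_enl M).symm.trans ((counitFunctor_obj_injective h).trans (enl_enl N))

end

end PartialMap

open PartialMap

/-- The counit at a join local category. -/
def counitHom (C : JLCat.{u}) : C ⟶ domCat (partialMapCat C) :=
  { toLocalFunctor := counitLocalFunctor C.carrier
    map_join := fun {K N ι M} f S s _ _ h => LocalFunctor.map_isJoin _
      (fun _ _ => counitLocalFunctor_obj_enl_injective) (fun p => by
        obtain ⟨M, hM⟩ := counitFunctor_obj_surjective p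
        exact ⟨M, eqToHom hM, (eqToIso hM).isIso_hom, .eqToHom hM⟩) h }

theorem isEquivalenceOne_counitHom (C : JLCat.{u}) : IsEquivalenceOne (counitHom C) := by
  have : (counitHom C).toFunctor.Full := inferInstanceAs (counitFunctor C.carrier).Full
  have : (counitHom C).toFunctor.Faithful := inferInstanceAs (counitFunctor C.carrier).Faithful
  exact JLCat.isEquivalenceOne_of_surjective _ (fun _ _ => counitLocalFunctor_obj_enl_injective)
    counitFunctor_obj_surjective

theorem CategoryTheory.comp_eqToHom_eq_comp_eqToHom_iff {C : Type u} [Category.{v} C]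
    {T M A B : C} {u : T ⟶ M} {i : M ⟶ A} {x : T ⟶ A}
    (h : A = B) : u ≫ i ≫ eqToHom h = x ≫ eqToHom h ↔ u ≫ i = x := by
  subst h
  simp

/-! ### Naturality of the counit. -/

namespace PartialMap

variable {C : Type u} [Category.{u} C] [JoinLocalCategory C]
  {D : Type u} [Category.{u} D] [JoinLocalCategory D]

theorem rep_ofHom {M N : C} (f : M ⟶ N) : (ofHom f).Rep (incl M) (f ≫ incl N) :=
  rep_ofRep _ _ _

theorem enlargement_map (F : JoinLocalFunctor C D) (M : C) :
    enlargement (F.obj M) = mapEnlarged F.toLocalFunctor (enlargement M) :=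
  Enlarged.ext (F.obj_enl M).symm

/-- Both idempotents are represented by the maximal inclusion of `F.obj M`, because `F` preserves
maximal inclusions strictly. -/
theorem counitFunctor_obj_map (F : JoinLocalFunctor C D) (M : C) :
    (counitFunctor D).obj (F.obj M) =
      (Dom.mapLocal (mapJoin F)).obj ((counitFunctor C).obj M) :=
  counitFunctor_obj_eq (F.obj_enl M).symm fun T t x => by
    refine (Rep.mapRel_iff F.toLocalFunctor (rep_ofHom (𝟙 M))).trans ?_
    rw [Category.id_comp, F.map_incl]
    rfl

/-- This is 2-naturality of the counit read on elements; its content is naturality of `θ` at the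
maximal inclusion of `M`. -/
theorem rel_ofHom_app_iff {F G : JoinLocalFunctor C D} (θ : NatTrans F.toFunctor G.toFunctor)
    {M : C} {T : D} (t : T ⟶ enl (F.obj M)) (x : T ⟶ G.obj (enl M)) :
    (ofHom (θ.app M)).rel T t (x ≫ eqToHom (G.obj_enl M)) ↔
      ∃ y, mapRel F.toLocalFunctor (ofHom (𝟙 M)) T (t ≫ eqToHom (F.obj_enl M).symm) y ∧
        y ≫ θ.app (enl M) = x := by
  have key : F.map (incl M) ≫ θ.app (enl M) =
      θ.app M ≫ incl (G.obj M) ≫ eqToHom (G.obj_enl M).symm := by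
    rw [θ.naturality, G.map_incl]
  have hF := fun y => Rep.mapRel_iff F.toLocalFunctor (rep_ofHom (𝟙 M)) (T := T)
    (t := t ≫ eqToHom (F.obj_enl M).symm) (x := y)
  simp only [Category.id_comp] at hF
  rw [rel_ofHom]
  constructor
  · rintro ⟨u, rfl, hu⟩
    refine ⟨u ≫ F.map (incl M), (hF _).2 ⟨u, ?_, rfl⟩, ?_⟩
    · rw [F.map_incl, Category.assoc]
    · rw [Category.assoc, key, ← Category.assoc (θ.app M), ← Category.assoc, hu]
      simp
  · rintro ⟨y, hy, rfl⟩
    obtain ⟨u, hu, rfl⟩ := (hF _).1 hy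
    refine ⟨u, ?_, ?_⟩
    · rwa [F.map_incl, comp_eqToHom_eq_comp_eqToHom_iff] at hu
    · rw [Category.assoc, Category.assoc, reassoc_of% key]
      simp

theorem counitFunctor_map_map (F : JoinLocalFunctor C D) {M N : C} (f : M ⟶ N) :
    (counitFunctor D).map (F.map f) = eqToHom (counitFunctor_obj_map F M) ≫
      (Dom.mapLocal (mapJoin F)).map ((counitFunctor C).map f) ≫
        eqToHom (counitFunctor_obj_map F N).symm := by
  refine Dom.hom_ext (Eq.trans ?_ ((Dom.eqToHom_comp_val (counitFunctor_obj_map F M) _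
    (enlargement_map F M)).trans (congrArg (eqToHom (enlargement_map F M) ≫ ·)
      (Dom.comp_eqToHom_val _ (counitFunctor_obj_map F N).symm
        (enlargement_map F N).symm))).symm)
  refine hom_ext fun T t x => ?_
  refine Iff.trans ?_ ((rel_eqToHom_comp (enlargement_map F M) _).trans
    (rel_comp_eqToHom (enlargement_map F N).symm _)).symm
  refine Iff.trans ?_ (Rep.mapRel_iff F.toLocalFunctor (rep_ofHom f)).symm
  refine rel_ofHom.trans (exists_congr fun u => ?_)
  rw [F.map_comp, F.map_incl, F.map_incl]
  refine and_congr ?_ ?_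
  · exact (comp_eqToHom_eq_comp_eqToHom_iff (F.obj_enl M).symm).symm
  · rw [← Category.assoc (F.map f)]
    exact (comp_eqToHom_eq_comp_eqToHom_iff (F.obj_enl N).symm).symm

end PartialMap

theorem counitHom_naturality {C D : JLCat.{u}} (F : C ⟶ D) :
    F ≫ counitHom D = counitHom C ≫ domFunctor.map (partialMapHom F) :=
  JLCat.hom_ext (CategoryTheory.Functor.ext (fun M => counitFunctor_obj_map F M)
    fun _ _ f => counitFunctor_map_map F f)

theorem JLCat.eqToHom_comp_app {X Y : JLCat.{u}} {F F' G : X ⟶ Y} (h : F = F') (φ : F' ⟶ G)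
    (A : X.carrier) : NatTrans.app (eqToHom h ≫ φ) A =
      eqToHom (congrArg (fun H : X ⟶ Y => H.obj A) h) ≫ NatTrans.app φ A := by
  subst h
  rfl

theorem JLCat.comp_eqToHom_app {X Y : JLCat.{u}} {F G' G : X ⟶ Y} (φ : F ⟶ G') (h : G' = G)
    (A : X.carrier) : NatTrans.app (φ ≫ eqToHom h) A =
      NatTrans.app φ A ≫ eqToHom (congrArg (fun H : X ⟶ Y => H.obj A) h) := by
  subst h
  rfl

/-- The counit of the 2-equivalence. -/
def counitTransformation :
    TwoNatTrans (StrictPseudofunctor.id JLCat.{u}) (partialMapFunctor.comp domFunctor) where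
  app := counitHom
  naturality F := counitHom_naturality F
  naturality₂ {C D F G} θ := JLCat.hom₂_ext fun M => by
    refine (JLCat.comp_eqToHom_app (X := C) (Y := domCat (partialMapCat D)) _ _ M).trans
      (Eq.trans ?_ (JLCat.eqToHom_comp_app (X := C) (Y := domCat (partialMapCat D)) _ _ M).symm)
    refine Dom.hom_ext ((Dom.comp_eqToHom_val _ (counitFunctor_obj_map G M)
      (enlargement_map G M)).trans (Eq.trans ?_ (Dom.eqToHom_comp_val (counitFunctor_obj_map F M) _
        (enlargement_map F M)).symm))
    refine hom_ext fun T t x => ?_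
    refine (PartialMap.rel_comp_eqToHom (enlargement_map G M) _).trans
      (Iff.trans ?_ (PartialMap.rel_eqToHom_comp (enlargement_map F M) _).symm)
    exact rel_ofHom_app_iff θ t x

theorem mainTheorem9 :
    ∃ E : TwoEquivalence JRCat.{u} JLCat.{u}, ∀ X : JRCat.{u}, IsIsoOne (E.unit.app X) := by
  have key : ∀ X : JRCat.{u}, IsEquivalenceOne (unitHom X) := fun X => by
    obtain ⟨g, h, h'⟩ := isIsoOne_unitHom X
    exact ⟨Bicategory.Equivalence.mkOfAdjointifyCounit (eqToIso h.symm) (eqToIso h'), rfl⟩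
  exact ⟨{ functor := domFunctor
           inverse := partialMapFunctor
           unit := unitTransformation
           unit_equivalence := key
           counit := counitTransformation
           counit_equivalence := isEquivalenceOne_counitHom }, isIsoOne_unitHom⟩
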